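/- Proposition 2.5. Let $M$ be a smooth manifold of dimension $2n+1$ with a contact metric structure: a contact $1$-form $\eta$ (that is, $\eta$ vanishes nowhere and $d\eta$ is nondegenerate on $\mathcal D=\ker\eta$), its Reeb vector field $\xi$ (determined by $\eta(\xi)=1$ and $\xi\rfloor d\eta=0$), a smooth field $J$ of endomorphisms of $\mathcal D$ with $$J^2=-\mathrm{id},\qquad d\eta(JX,JY)=d\eta(X,Y),\qquad d\eta(X,JX)>0\ \text{ for } X\neq 0 \qquad (X,Y\in\mathcal D),$$ its extension $\Phi$ to $TM$ by $\Phi|_{\mathcal D}=J$ and $\Phi\xi=0$, and the Riemannian metric $g(X,Y)=d\eta(X,\Phi Y)+\eta(X)\eta(Y)$. Assume that $(M,g)$ is complete. Then $\xi$ has a unique global smooth flow $(\varphi_t)_{t\in\mathbb R}$ on $M$ (the Reeb flow), and the following are equivalent: 1. $g$ is bundle-like with respect to the foliation spanned by $\xi$: every point of $M$ has an open neighbourhood $U$ with a smooth submersion $f:U\to\mathbb R^{2n}$ such that $\ker df=\mathbb R\,\xi$ on $U$, and a Riemannian metric $h$ on $f(U)$ such that $g(v,w)=h(df\,v,df\,w)$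 for all tangent vectors $v,w$ at a common point of $U$ that are orthogonal to $\xi$. 2. The Reeb flow is isometric: $\varphi_t^*g=g$ for all $t$. 3. The Reeb flow preserves $J$: for all $t$, $d\varphi_t$ maps $\mathcal D$ into $\mathcal D$ and $d\varphi_t\circ J=J\circ d\varphi_t$ on $\mathcal D$. 4. The Reeb flow preserves $\Phi$: $d\varphi_t\circ\Phi=\Phi\circ d\varphi_t$ for all $t$. 5. The structure is K-contact, that is, $\xi$ is a Killing vector field: $L_\xi g=0$. -/

import Mathlib

open Bundle Set Manifold
open scoped ContDiff Manifold

noncomputable section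

namespace ContactGeometry

section Manifolds

variable {E : Type*} [NormedAddCommGroup E] [NormedSpace ℝ E]
  {M : Type*} [TopologicalSpace M] [ChartedSpace E M]

/-- A (not necessarily smooth) vector field on a manifold `M` modelled on `E`. -/
abbrev VField (E : Type*) [NormedAddCommGroup E] [NormedSpace ℝ E]
    (M : Type*) [TopologicalSpace M] [ChartedSpace E M] : Type _ :=
  ∀ x : M, TangentSpace 𝓘(ℝ, E) x

/-- A (not necessarily smooth) 1-form. -/
abbrev OneForm (E : Type*) [NormedAddCommGroup E] [NormedSpace ℝ E]
    (M : Type*) [TopologicalSpace M] [ChartedSpace E M] : Type _ :=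
  ∀ x : M, TangentSpace 𝓘(ℝ, E) x →L[ℝ] ℝ

/-- A (not necessarily smooth) field of endomorphisms of the tangent spaces. -/
abbrev EndField (E : Type*) [NormedAddCommGroup E] [NormedSpace ℝ E]
    (M : Type*) [TopologicalSpace M] [ChartedSpace E M] : Type _ :=
  ∀ x : M, TangentSpace 𝓘(ℝ, E) x →L[ℝ] TangentSpace 𝓘(ℝ, E) x

/-- Smoothness of a vector field, as a section of the tangent bundle. -/
def SmoothVField [IsManifold 𝓘(ℝ, E) ∞ M] (X : VField E M) : Prop :=
  ContMDiff 𝓘(ℝ, E) (𝓘(ℝ, E).prod 𝓘(ℝ, E)) ∞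
    (fun x ↦ TotalSpace.mk' E (E := fun x : M ↦ TangentSpace 𝓘(ℝ, E) x) x (X x))

/-- Smoothness of a 1-form, as a section of the cotangent bundle. -/
def SmoothOneForm [IsManifold 𝓘(ℝ, E) ∞ M] (η : OneForm E M) : Prop :=
  ContMDiff 𝓘(ℝ, E) (𝓘(ℝ, E).prod 𝓘(ℝ, E →L[ℝ] ℝ)) ∞
    (fun x ↦ TotalSpace.mk' (E →L[ℝ] ℝ)
      (E := fun x : M ↦ TangentSpace 𝓘(ℝ, E) x →L[ℝ] Bundle.Trivial M ℝ x) x (η x))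

/-- Smoothness of a field of endomorphisms, as a section of `End TM`. -/
def SmoothEndField [IsManifold 𝓘(ℝ, E) ∞ M] (Φ : EndField E M) : Prop :=
  ContMDiff 𝓘(ℝ, E) (𝓘(ℝ, E).prod 𝓘(ℝ, E →L[ℝ] E)) ∞
    (fun x ↦ TotalSpace.mk' (E →L[ℝ] E)
      (E := fun x : M ↦ TangentSpace 𝓘(ℝ, E) x →L[ℝ] TangentSpace 𝓘(ℝ, E) x) x (Φ x))

/-- The expression of a 1-form in the preferred chart at `x`: the pullback of `η` under the
inverse of that chart. -/
def formInChart (η : OneForm E M) (x : M) : E → (E →L[ℝ] ℝ) := fun y ↦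
  (η ((extChartAt 𝓘(ℝ, E) x).symm y)).comp
    (mfderiv 𝓘(ℝ, E) 𝓘(ℝ, E) (extChartAt 𝓘(ℝ, E) x).symm y)

/-- The exterior derivative of a 1-form, computed in the preferred chart at `x`, with the
convention `dη(X,Y) = X(η(Y)) - Y(η(X)) - η([X,Y])`. -/
def dForm (η : OneForm E M) (x : M) (v w : TangentSpace 𝓘(ℝ, E) x) : ℝ :=
  let v' : E := mfderiv 𝓘(ℝ, E) 𝓘(ℝ, E) (extChartAt 𝓘(ℝ, E) x) x v
  let w' : E := mfderiv 𝓘(ℝ, E) 𝓘(ℝ, E) (extChartAt 𝓘(ℝ, E) x) x w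
  fderiv ℝ (formInChart η x) (extChartAt 𝓘(ℝ, E) x x) v' w'
    - fderiv ℝ (formInChart η x) (extChartAt 𝓘(ℝ, E) x x) w' v'

/-- `η` is a contact form: it vanishes nowhere and `dη` is nondegenerate on each hyperplane
`ker η_x` (on a manifold of dimension `2n+1` this says that `η ∧ (dη)^n` vanishes nowhere). -/
def IsContactForm (η : OneForm E M) : Prop :=
  ∀ x, η x ≠ 0 ∧
    ∀ v ∈ (η x).ker, (∀ w ∈ (η x).ker, dForm η x v w = 0) → v = 0

/-- `ξ` satisfies the conditions `η(ξ) = 1`, `ξ ⌟ dη = 0` that define the Reeb vector field. -/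
def IsReebField (η : OneForm E M) (ξ : VField E M) : Prop :=
  ∀ x, η x (ξ x) = 1 ∧ ∀ w, dForm η x (ξ x) w = 0

/-- The projection of `T_x M` onto `ker η_x` along `ξ_x`, when `η(ξ) = 1`. -/
def horizontalProj (η : OneForm E M) (ξ : VField E M) (h : IsReebField η ξ) (x : M) :
    TangentSpace 𝓘(ℝ, E) x →L[ℝ] (η x).ker :=
  (ContinuousLinearMap.id ℝ (TangentSpace 𝓘(ℝ, E) x) - (η x).smulRight (ξ x)).codRestrict
    (η x).ker (fun v ↦ by simp [LinearMap.mem_ker, (h x).1])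

/-- `φ` is the global smooth flow of the vector field `ξ`. -/
structure IsGlobalFlow [IsManifold 𝓘(ℝ, E) ∞ M] (ξ : VField E M) (φ : ℝ → M → M) : Prop where
  zero : ∀ x, φ 0 x = x
  integralCurve : ∀ x, IsMIntegralCurve (I := 𝓘(ℝ, E)) (fun t ↦ φ t x) ξ
  smooth : ContMDiff (𝓘(ℝ, ℝ).prod 𝓘(ℝ, E)) 𝓘(ℝ, E) ∞ (fun p : ℝ × M ↦ φ p.1 p.2)

/-- A flow leaves a field `Φ` of endomorphisms of the tangent spaces invariant. -/
def PreservesEnd (φ : ℝ → M → M) (Φ : EndField E M) : Prop :=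
  ∀ (t : ℝ) (x : M) (v : TangentSpace 𝓘(ℝ, E) x),
    mfderiv 𝓘(ℝ, E) 𝓘(ℝ, E) (φ t) x (Φ x v) =
      Φ (φ t x) (mfderiv 𝓘(ℝ, E) 𝓘(ℝ, E) (φ t) x v)

/-- A flow leaves a field `J` of endomorphisms of the subbundle `ker η` invariant:
its differentials map `ker η` to itself and commute with `J`. -/
def PreservesHorizontalEnd (φ : ℝ → M → M) (η : OneForm E M)
    (J : ∀ x, (η x).ker →L[ℝ] (η x).ker) : Prop :=
  ∀ (t : ℝ) (x : M) (v : (η x).ker),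
    ∃ h : mfderiv 𝓘(ℝ, E) 𝓘(ℝ, E) (φ t) x (v : TangentSpace 𝓘(ℝ, E) x) ∈ (η (φ t x)).ker,
      mfderiv 𝓘(ℝ, E) 𝓘(ℝ, E) (φ t) x (J x v : TangentSpace 𝓘(ℝ, E) x) = J (φ t x) ⟨_, h⟩

section Metric

variable [RiemannianBundle (fun x : M ↦ TangentSpace 𝓘(ℝ, E) x)]

/-- A flow acts by isometries of the Riemannian metric. -/
def IsIsometricFlow (φ : ℝ → M → M) : Prop :=
  ∀ (t : ℝ) (x : M) (v w : TangentSpace 𝓘(ℝ, E) x),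
    inner ℝ (mfderiv 𝓘(ℝ, E) 𝓘(ℝ, E) (φ t) x v) (mfderiv 𝓘(ℝ, E) 𝓘(ℝ, E) (φ t) x w)
      = inner ℝ v w

/-- The Lie derivative of the Riemannian metric:
`(L_ξ g)(X,Y) = ξ(g(X,Y)) - g([ξ,X],Y) - g(X,[ξ,Y])`. -/
def lieDerivMetric (ξ X Y : VField E M) (x : M) : ℝ :=
  let dg : ℝ := mfderiv 𝓘(ℝ, E) 𝓘(ℝ, ℝ) (fun y ↦ (inner ℝ (X y) (Y y) : ℝ)) x (ξ x)
  dg - inner ℝ (VectorField.mlieBracket 𝓘(ℝ, E) ξ X x) (Y x)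
    - inner ℝ (X x) (VectorField.mlieBracket 𝓘(ℝ, E) ξ Y x)

/-- `ξ` is a Killing vector field: `L_ξ g = 0`. -/
def IsKilling [IsManifold 𝓘(ℝ, E) ∞ M] (ξ : VField E M) : Prop :=
  ∀ X Y : VField E M, SmoothVField X → SmoothVField Y → ∀ x, lieDerivMetric ξ X Y x = 0

/-- The Riemannian metric is bundle-like with respect to the one-dimensional foliation, of
codimension `q`, spanned by the nowhere vanishing vector field `ξ`: near every point the foliation
is defined by a submersion `f` onto an open subset of `ℝ^q` (a local leaf space), and on vectors
orthogonal to the leaves the metric is the pullback under `f` of a Riemannian metric `h` on this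
local leaf space. -/
def IsBundleLike (q : ℕ) (ξ : VField E M) : Prop :=
  ∀ x : M, ∃ (U : Set M) (f : M → EuclideanSpace ℝ (Fin q))
    (h : EuclideanSpace ℝ (Fin q) →
      EuclideanSpace ℝ (Fin q) →L[ℝ] EuclideanSpace ℝ (Fin q) →L[ℝ] ℝ),
    IsOpen U ∧ x ∈ U ∧
    ContMDiffOn 𝓘(ℝ, E) 𝓘(ℝ, EuclideanSpace ℝ (Fin q)) ∞ f U ∧
    (∀ y ∈ U, Function.Surjective (mfderiv 𝓘(ℝ, E) 𝓘(ℝ, EuclideanSpace ℝ (Fin q)) f y)) ∧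
    (∀ y ∈ U, (mfderiv 𝓘(ℝ, E) 𝓘(ℝ, EuclideanSpace ℝ (Fin q)) f y).ker
      = Submodule.span ℝ {ξ y}) ∧
    ContDiffOn ℝ ∞ h (f '' U) ∧
    (∀ z ∈ f '' U, (∀ a b, h z a b = h z b a) ∧ ∀ a, a ≠ 0 → 0 < h z a a) ∧
    ∀ y ∈ U, ∀ v w : TangentSpace 𝓘(ℝ, E) y, inner ℝ (ξ y) v = 0 → inner ℝ (ξ y) w = 0 →
      inner ℝ v w = h (f y) (mfderiv 𝓘(ℝ, E) 𝓘(ℝ, EuclideanSpace ℝ (Fin q)) f y v)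
        (mfderiv 𝓘(ℝ, E) 𝓘(ℝ, EuclideanSpace ℝ (Fin q)) f y w)

/-- A contact metric structure on `M`, whose Riemannian metric `g` is the given one: a contact form
`η` with its Reeb vector field `ξ`, and an almost complex structure `J` on `D = ker η`
compatible with `dη`, such that `g(v,w) = dη(v,Φw) + η(v)η(w)`, where `Φ` is the extension of `J`
by `Φξ = 0`. Smoothness of `J` is expressed by that of `Φ`. -/
structure ContactMetricStructure (E : Type*) [NormedAddCommGroup E] [NormedSpace ℝ E]
    (M : Type*) [TopologicalSpace M] [ChartedSpace E M] [IsManifold 𝓘(ℝ, E) ∞ M]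
    [RiemannianBundle (fun x : M ↦ TangentSpace 𝓘(ℝ, E) x)] where
  η : OneForm E M
  smooth_η : SmoothOneForm η
  contact : IsContactForm η
  ξ : VField E M
  smooth_ξ : SmoothVField ξ
  reeb : IsReebField η ξ
  J : ∀ x, (η x).ker →L[ℝ] (η x).ker
  J_sq : ∀ x (v : (η x).ker), J x (J x v) = -v
  J_symplectic : ∀ x (v w : (η x).ker), dForm η x (J x v) (J x w) = dForm η x v w
  J_pos : ∀ x (v : (η x).ker), v ≠ 0 → 0 < dForm η x v (J x v)
  smooth_J : SmoothEndField (fun x ↦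
    (η x).ker.subtypeL.comp ((J x).comp (horizontalProj η ξ reeb x)))
  metric_eq : ∀ x (v w : TangentSpace 𝓘(ℝ, E) x),
    inner ℝ v w = dForm η x v (J x (horizontalProj η ξ reeb x w)) + η x v * η x w

namespace ContactMetricStructure

variable [IsManifold 𝓘(ℝ, E) ∞ M]

/-- The (1,1) tensor field `Φ`, equal to `J` on `ker η` and with `Φ ξ = 0`. -/
def Φ (S : ContactMetricStructure E M) : EndField E M := fun x ↦
  (S.η x).ker.subtypeL.comp ((S.J x).comp (horizontalProj S.η S.ξ S.reeb x))

/-- A contact metric structure is K-contact if its Reeb vector field is Killing. -/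
def IsKContact (S : ContactMetricStructure E M) : Prop := IsKilling S.ξ

end ContactMetricStructure

end Metric

end Manifolds

end ContactGeometry

end

/-! Completeness. Since `ξ ⌟ dη = 0` and `η(ξ) = 1`, the formula for `g` gives `g(ξ,ξ) = 1`. An
integral curve of `ξ` therefore does not increase distances, so over a bounded time interval it has
limits at the ends, where the local flow continues it (`exists_isMIntegralCurve_of_unit`). Joint
smoothness in time and initial value comes from a local flow built with the inverse function theorem
on the Banach space of paths (`exists_local_flow`), spread over all times by the group law
(`isGlobalFlow_of_isMIntegralCurve`).

Invariance. Cartan's formula gives `L_ξ η = d(η(ξ)) + ξ ⌟ dη = 0`, so the flow preserves `η`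
(`form_mfderiv_flow`), hence `dη` (`dForm_mfderiv_of_preserves`), and as always it preserves `ξ`. In
`g = dη(·,Φ·) + η ⊗ η` the only ingredient that can change along the flow is thus `Φ`. Invariance of
`Φ` gives invariance of `g`, and conversely because `dη` is nondegenerate on `ker η`. Conditions 3
and 4 agree because `Φ` is determined by `J` and the invariant splitting `ker η ⊕ ℝξ`.

Killing fields. The derivative at time `0` of `φ_t^* g` is `L_ξ g`; by the group law its vanishing
everywhere makes `φ_t^* g` constant (`isKilling_iff_isIsometricFlow`).

Bundle-like metrics. The condition says that locally `g = f^*h + η ⊗ η`. As `f` is constant along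
orbits and `η` is invariant, `φ_t^* g = g` for small `t` at each point, which suffices
(`isIsometricFlow_of_isBundleLike`). Conversely, in a flow box `(t,z) ↦ φ_t(σ(z))` over a slice `σ`
transverse to `ξ`, let `f` be the coordinate `z` and `h` the restriction of `g - η ⊗ η` to the
slice; an isometric flow carries this form unchanged along the orbits
(`isBundleLike_of_isIsometricFlow`). -/

noncomputable section

namespace ContactGeometry

/-! ### Inverse function theorem with a smooth inverse -/

section InverseFunction

variable {E F : Type*} [NormedAddCommGroup E] [NormedSpace ℝ E] [CompleteSpace E]
  [NormedAddCommGroup F] [NormedSpace ℝ F]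

/-- The inverse function theorem, with smoothness of the local inverse on its whole domain. -/
theorem exists_openPartialHomeomorph_contDiffOn {f : E → F} {O : Set E} (hO : IsOpen O)
    (hf : ContDiffOn ℝ ∞ f O) {a : E} (ha : a ∈ O) {f' : E ≃L[ℝ] F}
    (hf' : HasFDerivAt f (f' : E →L[ℝ] F) a) :
    ∃ e : OpenPartialHomeomorph E F, a ∈ e.source ∧ e.source ⊆ O ∧ (∀ x, e x = f x) ∧
      ContDiffOn ℝ ∞ e.symm e.target := by
  have hfa : ContDiffAt ℝ ∞ f a := hf.contDiffAt (hO.mem_nhds ha)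
  let e₀ := hfa.toOpenPartialHomeomorph f hf' (by simp)
  -- Invertible operators form an open set. Shrinking the source to the points with invertible
  -- differential makes the inverse smooth on the whole target, not only at the image of `a`.
  let S : Set E := O ∩ fderiv ℝ f ⁻¹' range ((↑) : (E ≃L[ℝ] F) → E →L[ℝ] F)
  have hS : IsOpen S :=
    (hf.continuousOn_fderiv_of_isOpen hO (by simp)).isOpen_inter_preimage hO
      ContinuousLinearEquiv.isOpen
  refine ⟨e₀.restrOpen S hS, ?_, ?_, fun x ↦ rfl, ?_⟩
  · rw [OpenPartialHomeomorph.restrOpen_source]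
    exact ⟨hfa.mem_toOpenPartialHomeomorph_source hf' (by simp), ha, f', hf'.fderiv.symm⟩
  · rw [OpenPartialHomeomorph.restrOpen_source]
    exact fun x hx ↦ hx.2.1
  · intro y hy
    have hy' := (e₀.restrOpen S hS).map_target hy
    rw [OpenPartialHomeomorph.restrOpen_source] at hy'
    obtain ⟨hO', g', hg'⟩ := hy'.2
    have hc : ContDiffAt ℝ ∞ f ((e₀.restrOpen S hS).symm y) := hf.contDiffAt (hO.mem_nhds hO')
    refine ((e₀.restrOpen S hS).contDiffAt_symm hy (f₀' := g') ?_ hc).contDiffWithinAt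
    rw [hg']
    exact (hc.differentiableAt (by simp)).hasFDerivAt

end InverseFunction

/-! ### Smoothness of composition operators on spaces of continuous functions -/

section Superposition

universe u

variable {K : Type*} [TopologicalSpace K] [CompactSpace K]
  {E F H : Type*} [NormedAddCommGroup E] [NormedSpace ℝ E] [NormedAddCommGroup F] [NormedSpace ℝ F]
  [NormedAddCommGroup H] [NormedSpace ℝ H]

/-- The pointwise extension of a continuous bilinear map to continuous functions on a compact
space. -/
def pointwiseBilin (L : H →L[ℝ] E →L[ℝ] F) : C(K, H) →L[ℝ] C(K, E) →L[ℝ] C(K, F) :=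
  LinearMap.mkContinuous₂
    (LinearMap.mk₂ ℝ (fun (A : C(K, H)) (h : C(K, E)) ↦
      (⟨fun k ↦ L (A k) (h k), by fun_prop⟩ : C(K, F)))
      (fun _ _ _ ↦ by ext; simp) (fun _ _ _ ↦ by ext; simp) (fun _ _ _ ↦ by ext; simp)
      (fun _ _ _ ↦ by ext; simp)) ‖L‖
    (fun A h ↦ by
      rw [ContinuousMap.norm_le _ (by positivity)]
      intro k
      refine (L.le_opNorm₂ (A k) (h k)).trans ?_
      gcongr
      · exact A.norm_coe_le_norm k
      · exact h.norm_coe_le_norm k)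

@[simp]
theorem pointwiseBilin_apply (L : H →L[ℝ] E →L[ℝ] F) (A : C(K, H)) (h : C(K, E)) (k : K) :
    pointwiseBilin L A h k = L (A k) (h k) := rfl

/-- The mean value inequality on the segment from `γ k` to `γ' k` gives the estimate pointwise; it
is uniform in `k` because `γ ↦ f' ∘ γ` is continuous for the sup norm, `K` being compact. That
continuity replaces uniform continuity of `f'`. -/
theorem hasFDerivAt_continuousMap_comp (L : H →L[ℝ] E →L[ℝ] F) {f : C(E, F)} {f' : C(E, H)}
    (hf : ∀ y, HasFDerivAt f (L (f' y)) y) (γ : C(K, E)) :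
    HasFDerivAt (fun γ : C(K, E) ↦ f.comp γ) (pointwiseBilin L (f'.comp γ)) γ := by
  rw [hasFDerivAt_iff_isLittleO, Asymptotics.isLittleO_iff]
  intro ε hε
  obtain ⟨η, hη, hηε⟩ : ∃ η > 0, ‖L‖ * η ≤ ε := by
    refine ⟨ε / (‖L‖ + 1), by positivity, ?_⟩
    rw [mul_div_assoc', div_le_iff₀ (by positivity)]
    nlinarith [norm_nonneg L]
  have hcont := (ContinuousMap.continuous_postcomp (X := K) f').tendsto γ
  obtain ⟨δ, hδ, hball⟩ := Metric.mem_nhds_iff.1 (hcont (Metric.ball_mem_nhds _ hη))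
  filter_upwards [Metric.ball_mem_nhds γ hδ] with γ' hγ'
  rw [ContinuousMap.norm_le _ (by positivity)]
  intro k
  have key : ‖f (γ' k) - f (γ k) - L (f' (γ k)) (γ' k - γ k)‖ ≤ ε * ‖γ' k - γ k‖ := by
    refine (convex_segment (γ k) (γ' k)).norm_image_sub_le_of_norm_hasFDerivWithin_le'
      (fun y _ ↦ (hf y).hasFDerivWithinAt) ?_
      (left_mem_segment ..) (right_mem_segment ..)
    intro y hy
    rw [segment_eq_image'] at hy
    obtain ⟨s, hs, rfl⟩ := hy
    have hmem : γ + s • (γ' - γ) ∈ Metric.ball γ δ := by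
      rw [Metric.mem_ball, dist_eq_norm, add_sub_cancel_left, norm_smul, Real.norm_of_nonneg hs.1]
      rw [Metric.mem_ball, dist_eq_norm] at hγ'
      exact (mul_le_of_le_one_left (norm_nonneg _) hs.2).trans_lt hγ'
    have h2 := hball hmem
    rw [mem_preimage, Metric.mem_ball, dist_eq_norm] at h2
    rw [← map_sub]
    refine (L.le_opNorm _).trans (le_trans ?_ hηε)
    gcongr
    exact (ContinuousMap.norm_coe_le_norm _ k).trans h2.le
  refine (le_trans (le_of_eq ?_) key).trans
    (mul_le_mul_of_nonneg_left (ContinuousMap.norm_coe_le_norm (γ' - γ) k) hε.le)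
  simp

/-- The derivative is the composition operator of `fderiv ℝ f` followed by a fixed continuous linear
map, so the order of smoothness rises by induction. The target `F` varies, since the induction
passes to `E →L[ℝ] F`; hence the common universe. -/
theorem contDiff_nat_continuousMap_comp {E : Type u} [NormedAddCommGroup E] [NormedSpace ℝ E]
    (n : ℕ) : ∀ {F : Type u} [NormedAddCommGroup F] [NormedSpace ℝ F] (f : C(E, F)),
      ContDiff ℝ ∞ f → ContDiff ℝ n (fun γ : C(K, E) ↦ f.comp γ) := by
  induction n with
  | zero =>
    intro F _ _ f hf
    exact contDiff_zero.2 (ContinuousMap.continuous_postcomp f)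
  | succ n ih =>
    intro F _ _ f hf
    let f' : C(E, E →L[ℝ] F) := ⟨fderiv ℝ f, hf.continuous_fderiv (by simp)⟩
    have hf' : ContDiff ℝ ∞ f' := hf.fderiv_right (m := ∞) (by simp)
    refine (contDiff_succ_iff_hasFDerivAt (n := n)).2
      ⟨fun γ ↦ pointwiseBilin (.id ℝ (E →L[ℝ] F)) (f'.comp γ), ?_, fun γ ↦ ?_⟩
    · exact (pointwiseBilin (K := K) (.id ℝ (E →L[ℝ] F))).contDiff.comp (ih f' hf')
    · exact hasFDerivAt_continuousMap_comp (.id ℝ (E →L[ℝ] F))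
        (fun y ↦ (hf.differentiable (by simp) y).hasFDerivAt) γ

/-- The superposition operator of a smooth map is smooth. -/
theorem contDiff_continuousMap_comp {E F : Type u} [NormedAddCommGroup E] [NormedSpace ℝ E]
    [NormedAddCommGroup F] [NormedSpace ℝ F] (f : C(E, F)) (hf : ContDiff ℝ ∞ f) :
    ContDiff ℝ ∞ (fun γ : C(K, E) ↦ f.comp γ) :=
  contDiff_infty.2 fun n ↦ contDiff_nat_continuousMap_comp n f hf

end Superposition

/-! ### Local flows in a Banach space, by the inverse function theorem on paths -/

section LocalFlow

open unitInterval

variable {E : Type*} [NormedAddCommGroup E] [NormedSpace ℝ E]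

/-- The operator sending `γ` to its primitive `t ↦ ∫ τ in 0..t, γ τ` on the unit interval. -/
def primitiveL : C(I, E) →L[ℝ] C(I, E) :=
  LinearMap.mkContinuous
    { toFun := fun γ ↦ ⟨fun t ↦ ∫ τ in (0 : ℝ)..t, γ (projIcc 0 1 zero_le_one τ),
        (intervalIntegral.continuous_primitive (fun a b ↦
          (γ.continuous.comp continuous_projIcc).intervalIntegrable a b) 0).comp
            continuous_subtype_val⟩
      map_add' := fun γ γ' ↦ by
        ext t
        exact intervalIntegral.integral_add
          ((γ.continuous.comp continuous_projIcc).intervalIntegrable _ _)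
          ((γ'.continuous.comp continuous_projIcc).intervalIntegrable _ _)
      map_smul' := fun c γ ↦ by
        ext t
        exact intervalIntegral.integral_smul c _ } 1
    (fun γ ↦ by
      rw [ContinuousMap.norm_le _ (by positivity)]
      intro t
      refine (intervalIntegral.norm_integral_le_of_norm_le_const
        (C := ‖γ‖) fun τ _ ↦ γ.norm_coe_le_norm _).trans ?_
      rw [sub_zero, abs_of_nonneg t.2.1, one_mul]
      exact mul_le_of_le_one_right (norm_nonneg _) t.2.2)

theorem primitiveL_apply (γ : C(I, E)) (t : I) :
    primitiveL γ t = ∫ τ in (0 : ℝ)..t, γ (projIcc 0 1 zero_le_one τ) := rfl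

/-- Constant functions on the unit interval. -/
def constL : E →L[ℝ] C(I, E) :=
  LinearMap.mkContinuous
    { toFun := fun x ↦ ContinuousMap.const I x
      map_add' := fun _ _ ↦ rfl
      map_smul' := fun _ _ ↦ rfl } 1
    (fun x ↦ by
      rw [ContinuousMap.norm_le _ (by positivity)]
      intro t
      rw [one_mul]
      exact le_rfl)

@[simp]
theorem constL_apply (x : E) (t : I) : constL x t = x := rfl

/-- The equation `γ = x + s ∫ X ∘ γ` for integral curves, rescaled to the unit interval. -/
def integralEquation (X : C(E, E)) (p : E × ℝ × C(I, E)) : E × ℝ × C(I, E) :=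
  (p.1, p.2.1, p.2.2 - constL p.1 - p.2.1 • primitiveL (X.comp p.2.2))

theorem contDiff_integralEquation (X : C(E, E)) (hX : ContDiff ℝ ∞ X) :
    ContDiff ℝ ∞ (integralEquation X) := by
  have h := contDiff_continuousMap_comp (K := I) X hX
  unfold integralEquation
  refine contDiff_fst.prodMk ((contDiff_fst.comp contDiff_snd).prodMk ?_)
  refine ((contDiff_snd.comp contDiff_snd).sub ((constL (E := E)).contDiff.comp contDiff_fst)).sub ?_
  exact (contDiff_fst.comp contDiff_snd).smul
    (primitiveL.contDiff.comp (h.comp (contDiff_snd.comp contDiff_snd)))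

/-- The linear automorphism `(x, s, γ) ↦ (x, s, γ - x - s c)`. -/
def shearEquiv (c : C(I, E)) : (E × ℝ × C(I, E)) ≃L[ℝ] (E × ℝ × C(I, E)) :=
  let fst := ContinuousLinearMap.fst ℝ E (ℝ × C(I, E))
  let snd := ContinuousLinearMap.snd ℝ E (ℝ × C(I, E))
  let time := (ContinuousLinearMap.fst ℝ ℝ C(I, E)).comp snd
  let path := (ContinuousLinearMap.snd ℝ ℝ C(I, E)).comp snd
  ContinuousLinearEquiv.equivOfInverse
    (fst.prod (time.prod (path - constL.comp fst - time.smulRight c)))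
    (fst.prod (time.prod (path + constL.comp fst + time.smulRight c)))
    (fun p ↦ Prod.ext rfl (Prod.ext rfl (by simp [fst, snd, time, path]; abel)))
    (fun p ↦ Prod.ext rfl (Prod.ext rfl (by simp [fst, snd, time, path]; abel)))

/-- At `s = 0` the factor `s` kills the derivative of `X ∘ γ`, so that only a shear is left, which
is invertible whatever `X` is. -/
theorem hasFDerivAt_integralEquation (X : C(E, E)) (hX : ContDiff ℝ ∞ X) (x₀ : E) :
    HasFDerivAt (integralEquation X)
      (shearEquiv (primitiveL (X.comp (constL x₀))) : (E × ℝ × C(I, E)) →L[ℝ] _)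
      (x₀, 0, constL x₀) := by
  have h := contDiff_continuousMap_comp (K := I) X hX
  let a : E × ℝ × C(I, E) := (x₀, 0, constL x₀)
  have h1 : HasFDerivAt (fun p : E × ℝ × C(I, E) ↦ p.1) (.fst ℝ E (ℝ × C(I, E))) a :=
    hasFDerivAt_fst
  have h2 : HasFDerivAt (fun p : E × ℝ × C(I, E) ↦ p.2.1)
      ((ContinuousLinearMap.fst ℝ ℝ C(I, E)).comp (.snd ℝ E (ℝ × C(I, E)))) a :=
    hasFDerivAt_fst.comp a hasFDerivAt_snd
  have h3 : HasFDerivAt (fun p : E × ℝ × C(I, E) ↦ p.2.2)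
      ((ContinuousLinearMap.snd ℝ ℝ C(I, E)).comp (.snd ℝ E (ℝ × C(I, E)))) a :=
    hasFDerivAt_snd.comp a hasFDerivAt_snd
  have h4 : DifferentiableAt ℝ (fun p : E × ℝ × C(I, E) ↦ primitiveL (X.comp p.2.2)) a :=
    ((primitiveL (E := E)).contDiff.comp (h.comp (contDiff_snd.comp contDiff_snd))).differentiable
      (by simp) a
  have h5 := h1.prodMk (h2.prodMk ((h3.sub (constL.hasFDerivAt.comp a h1)).sub
    (h2.smul h4.hasFDerivAt)))
  refine h5.congr_fderiv ?_
  ext p <;> simp [shearEquiv, a]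

/-- A substitution in the integral. It shows that slowing a solution for time `s` down by the factor
`θ` gives a solution for time `θ s`. -/
theorem primitiveL_comp_mul (f : C(I, E)) (s : ℝ) (θ t : I) :
    (θ * s : ℝ) • primitiveL (f.comp ⟨fun t ↦ θ * t, by fun_prop⟩) t
      = s • primitiveL f (θ * t) := by
  rw [mul_comm, mul_smul, primitiveL_apply, primitiveL_apply]
  congr 1
  have : ∀ τ ∈ uIcc (0 : ℝ) t, f.comp ⟨fun t ↦ θ * t, by fun_prop⟩ (projIcc 0 1 zero_le_one τ)
      = f (projIcc 0 1 zero_le_one (θ * τ)) := by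
    intro τ hτ
    rw [uIcc_of_le t.2.1] at hτ
    have hτ' : τ ∈ Icc (0 : ℝ) 1 := ⟨hτ.1, hτ.2.trans t.2.2⟩
    have hθ : (θ * τ : ℝ) ∈ Icc (0 : ℝ) 1 :=
      ⟨mul_nonneg θ.2.1 hτ.1, mul_le_one₀ θ.2.2 hτ.1 hτ'.2⟩
    rw [projIcc_of_mem _ hτ', projIcc_of_mem _ hθ]
    rfl
  rw [intervalIntegral.integral_congr this,
    intervalIntegral.smul_integral_comp_mul_left (fun τ ↦ f (projIcc 0 1 zero_le_one τ)), mul_zero]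
  rfl

/-- Existence of a local flow of a smooth vector field, smooth in time and initial value. -/
theorem exists_local_flow [CompleteSpace E] {X : E → E} (hX : ContDiff ℝ ∞ X) (x₀ : E) :
    ∃ r > 0, ∃ ψ : ℝ × E → E, ContDiffOn ℝ ∞ ψ (Ioo (-r) r ×ˢ Metric.ball x₀ r) ∧
      (∀ x ∈ Metric.ball x₀ r, ψ (0, x) = x) ∧
      ∀ x ∈ Metric.ball x₀ r, ∀ s ∈ Ioo (-r) r,
        HasDerivAt (fun s ↦ ψ (s, x)) (X (ψ (s, x))) s := by
  let Xc : C(E, E) := ⟨X, hX.continuous⟩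
  let a : E × ℝ × C(I, E) := (x₀, 0, constL x₀)
  obtain ⟨e, hae, -, he, hsymm⟩ := exists_openPartialHomeomorph_contDiffOn isOpen_univ
    (contDiff_integralEquation Xc hX).contDiffOn (mem_univ a)
    (hasFDerivAt_integralEquation Xc hX x₀)
  obtain ⟨δ, hδ, hball⟩ := Metric.isOpen_iff.1 e.open_source a hae
  let j : ℝ × E → E × ℝ × C(I, E) := fun p ↦ (p.2, p.1, 0)
  have hj : ContDiff ℝ ∞ j := contDiff_snd.prodMk (contDiff_fst.prodMk contDiff_const)
  have hW : IsOpen (j ⁻¹' (e.target ∩ e.symm ⁻¹' Metric.ball a δ)) :=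
    (e.symm.isOpen_inter_preimage Metric.isOpen_ball).preimage hj.continuous
  have hja : j (0, x₀) = e a := by
    rw [he]
    simp [j, a, integralEquation]
  have hmem : ((0 : ℝ), x₀) ∈ j ⁻¹' (e.target ∩ e.symm ⁻¹' Metric.ball a δ) := by
    rw [mem_preimage, hja]
    exact ⟨e.map_source hae, by rw [mem_preimage, e.left_inv hae]; exact Metric.mem_ball_self hδ⟩
  obtain ⟨r₀, hr₀, hr₀W⟩ := Metric.isOpen_iff.1 hW _ hmem
  -- The bound by `δ` keeps every time `θ * s` in the ball on which the integral equation is known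
  -- to be injective.
  let r := min r₀ δ
  have hr : 0 < r := lt_min hr₀ hδ
  have hrW : Ioo (-r) r ×ˢ Metric.ball x₀ r ⊆ j ⁻¹' (e.target ∩ e.symm ⁻¹' Metric.ball a δ) := by
    rintro ⟨s, x⟩ ⟨hs, hx⟩
    refine hr₀W ?_
    rw [← ball_prod_same]
    refine ⟨?_, Metric.ball_subset_ball (min_le_left _ _) hx⟩
    rw [Real.ball_eq_Ioo]
    have := min_le_left r₀ δ
    exact ⟨by linarith [hs.1], by linarith [hs.2]⟩
  let γ : ℝ → E → C(I, E) := fun s x ↦ (e.symm (j (s, x))).2.2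
  have hγe : ∀ s ∈ Ioo (-r) r, ∀ x ∈ Metric.ball x₀ r,
      e.symm (j (s, x)) = (x, s, γ s x) ∧
      γ s x - constL x - s • primitiveL (Xc.comp (γ s x)) = 0 := by
    intro s hs x hx
    have h1 := e.right_inv (hrW (mk_mem_prod hs hx)).1
    rw [he] at h1
    have hx1 : (e.symm (j (s, x))).1 = x := congrArg Prod.fst h1
    have hs1 : (e.symm (j (s, x))).2.1 = s := congrArg (fun p ↦ p.2.1) h1
    refine ⟨Prod.ext hx1 (Prod.ext hs1 rfl), ?_⟩
    have h2 : _ = (0 : C(I, E)) := congrArg (fun p ↦ p.2.2) h1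
    simpa only [integralEquation, hx1, hs1] using h2
  have hγeq : ∀ s ∈ Ioo (-r) r, ∀ x ∈ Metric.ball x₀ r, ∀ t : I,
      γ s x t - x - s • primitiveL (Xc.comp (γ s x)) t = 0 := fun s hs x hx t ↦
    congrArg (fun f : C(I, E) ↦ f t) (hγe s hs x hx).2
  -- Both paths solve the integral equation for time `θ * s`. The rescaled one takes only values of
  -- `γ s x`, so it stays within `δ` of the constant path, and injectivity on `e.source` identifies
  -- the two.
  have hscale : ∀ s ∈ Ioo (-r) r, ∀ x ∈ Metric.ball x₀ r, ∀ θ : I,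
      γ (θ * s) x = (γ s x).comp ⟨fun t ↦ θ * t, by fun_prop⟩ := by
    intro s hs x hx θ
    have hθs : (θ * s : ℝ) ∈ Ioo (-r) r := by
      rw [mem_Ioo, ← abs_lt] at hs ⊢
      rw [abs_mul, abs_of_nonneg θ.2.1]
      exact (mul_le_of_le_one_left (abs_nonneg _) θ.2.2).trans_lt hs
    have hb := (hrW (mk_mem_prod hs hx)).2
    rw [mem_preimage, (hγe s hs x hx).1, ← ball_prod_same, ← ball_prod_same] at hb
    have hrδ : r ≤ δ := min_le_right _ _
    have hmem' : (x, (θ * s : ℝ), (γ s x).comp ⟨fun t ↦ θ * t, by fun_prop⟩) ∈ e.source := by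
      refine hball ?_
      rw [← ball_prod_same, ← ball_prod_same]
      refine ⟨hb.1, ?_, ?_⟩
      · rw [Real.ball_eq_Ioo]
        exact ⟨by linarith [hθs.1], by linarith [hθs.2]⟩
      · have hb' := hb.2.2
        rw [Metric.mem_ball, ContinuousMap.dist_lt_iff hδ] at hb' ⊢
        exact fun t ↦ hb' (θ * t)
    have hmem'' : (x, (θ * s : ℝ), γ (θ * s) x) ∈ e.source := by
      rw [← (hγe _ hθs x hx).1]
      exact e.map_target (hrW (mk_mem_prod hθs hx)).1
    have heq := e.injOn hmem'' hmem' (by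
      rw [he, he]
      refine Prod.ext rfl (Prod.ext rfl ?_)
      refine ((hγe _ hθs x hx).2).trans ?_
      ext t
      have h1 := hγeq s hs x hx (θ * t)
      rw [← primitiveL_comp_mul] at h1
      exact h1.symm)
    exact congrArg (fun p ↦ p.2.2) heq
  refine ⟨r, hr, fun p ↦ γ p.1 p.2 1, ?_, ?_, ?_⟩
  · have h1 : ContDiffOn ℝ ∞ (fun p ↦ e.symm (j p)) (Ioo (-r) r ×ˢ Metric.ball x₀ r) :=
      hsymm.comp hj.contDiffOn (fun p hp ↦ (hrW hp).1)
    exact (ContinuousMap.evalCLM ℝ (1 : I)).contDiff.comp_contDiffOn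
      ((contDiff_snd.comp contDiff_snd).comp_contDiffOn h1)
  · intro x hx
    have h0 := hγeq 0 ⟨by linarith, hr⟩ x hx 1
    rw [zero_smul, sub_zero, sub_eq_zero] at h0
    exact h0
  · intro x hx s hs
    -- By the scaling identity the path `γ s x` is `t ↦ ψ (s t, x)`, so the rescaled equation at `t
    -- = 1` becomes the usual integral equation for `ψ (·, x)`.
    have hint : ∀ s ∈ Ioo (-r) r, γ s x 1 = x + ∫ τ in (0 : ℝ)..s, X (γ τ x 1) := by
      intro s hs
      have h1 := hγeq s hs x hx 1
      rw [sub_eq_zero, sub_eq_iff_eq_add, primitiveL_apply] at h1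
      rw [h1, add_comm]
      congr 1
      have : ∀ τ ∈ uIcc (0 : ℝ) 1, Xc.comp (γ s x) (projIcc 0 1 zero_le_one τ)
          = X (γ (s * τ) x 1) := by
        intro τ hτ
        rw [uIcc_of_le zero_le_one] at hτ
        have h2 := congrArg (fun f : C(I, E) ↦ f 1) (hscale s hs x hx ⟨τ, hτ⟩)
        rw [mul_comm s τ, projIcc_of_mem _ hτ]
        refine congrArg X (Eq.trans ?_ h2.symm)
        simp
      rw [show ((1 : I) : ℝ) = 1 from rfl, intervalIntegral.integral_congr this,
        intervalIntegral.smul_integral_comp_mul_left (fun τ ↦ X (γ τ x 1)), mul_zero, mul_one]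
    have hcont : ContinuousOn (fun τ ↦ X (γ τ x 1)) (Ioo (-r) r) := by
      have h1 : ContinuousOn (fun p ↦ e.symm (j p)) (Ioo (-r) r ×ˢ Metric.ball x₀ r) :=
        hsymm.continuousOn.comp hj.continuous.continuousOn (fun p hp ↦ (hrW hp).1)
      have h2 : ContinuousOn (fun τ : ℝ ↦ e.symm (j (τ, x))) (Ioo (-r) r) :=
        h1.comp (f := fun τ : ℝ ↦ (τ, x)) (by fun_prop) (fun τ hτ ↦ mk_mem_prod hτ hx)
      have h3 : Continuous fun p : E × ℝ × C(I, E) ↦ X (p.2.2 1) :=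
        hX.continuous.comp ((ContinuousMap.evalCLM ℝ (1 : I)).continuous.comp
          (continuous_snd.comp continuous_snd))
      exact h3.comp_continuousOn h2
    have hderiv : HasDerivAt (fun s ↦ x + ∫ τ in (0 : ℝ)..s, X (γ τ x 1)) (X (γ s x 1)) s := by
      refine (intervalIntegral.integral_hasDerivAt_right ?_ ?_ ?_).const_add x
      · refine (hcont.mono ?_).intervalIntegrable
        intro τ hτ
        exact (ordConnected_Ioo.uIcc_subset ⟨by linarith, hr⟩ hs) hτ
      · exact hcont.stronglyMeasurableAtFilter isOpen_Ioo s hs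
      · exact hcont.continuousAt (isOpen_Ioo.mem_nhds hs)
    refine hderiv.congr_of_eventuallyEq ?_
    filter_upwards [isOpen_Ioo.mem_nhds hs] with τ hτ using hint τ hτ

end LocalFlow

/-! ### Vector fields, forms and tensors in a preferred chart -/

section Charts

variable {E : Type*} [NormedAddCommGroup E] [NormedSpace ℝ E]
  {M : Type*} [TopologicalSpace M] [ChartedSpace E M]

/-- The differential at `y` of the preferred chart at `x`. -/
def chartD (x y : M) : TangentSpace 𝓘(ℝ, E) y →L[ℝ] E :=
  mfderiv 𝓘(ℝ, E) 𝓘(ℝ, E) (extChartAt 𝓘(ℝ, E) x) y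

/-- The differential at `u` of the inverse of the preferred chart at `x`. -/
def chartDInv (x : M) (u : E) : E →L[ℝ] TangentSpace 𝓘(ℝ, E) ((extChartAt 𝓘(ℝ, E) x).symm u) :=
  mfderiv 𝓘(ℝ, E) 𝓘(ℝ, E) (extChartAt 𝓘(ℝ, E) x).symm u

/-- The expression of a vector field in the preferred chart at `x`. -/
def fieldInChart (X : VField E M) (x : M) (u : E) : E :=
  chartD x ((extChartAt 𝓘(ℝ, E) x).symm u) (X ((extChartAt 𝓘(ℝ, E) x).symm u))

/-- The expression of a covariant 2-tensor field in the preferred chart at `x`. -/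
def tensorInChart
    (g : ∀ x : M, TangentSpace 𝓘(ℝ, E) x →L[ℝ] TangentSpace 𝓘(ℝ, E) x →L[ℝ] ℝ) (x : M) (u : E) :
    E →L[ℝ] E →L[ℝ] ℝ :=
  (ContinuousLinearMap.precomp ℝ (chartDInv x u)).comp
    ((g ((extChartAt 𝓘(ℝ, E) x).symm u)).comp (chartDInv x u))

theorem tensorInChart_apply
    (g : ∀ x : M, TangentSpace 𝓘(ℝ, E) x →L[ℝ] TangentSpace 𝓘(ℝ, E) x →L[ℝ] ℝ) (x : M)
    (u v w : E) :
    tensorInChart g x u v w =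
      g ((extChartAt 𝓘(ℝ, E) x).symm u) (chartDInv x u v) (chartDInv x u w) := rfl

theorem formInChart_apply (η : OneForm E M) (x : M) (u v : E) :
    formInChart η x u v = η ((extChartAt 𝓘(ℝ, E) x).symm u) (chartDInv x u v) := rfl

variable [IsManifold 𝓘(ℝ, E) ∞ M]

theorem chartD_self (x : M) (v : TangentSpace 𝓘(ℝ, E) x) : chartD x x v = v := by
  unfold chartD
  rw [mfderiv_extChartAt_self]
  rfl

theorem chartD_chartDInv {x : M} {u : E} (hu : u ∈ (extChartAt 𝓘(ℝ, E) x).target) (v : E) :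
    chartD x ((extChartAt 𝓘(ℝ, E) x).symm u) (chartDInv x u v) = v := by
  have h := mfderiv_extChartAt_comp_mfderivWithin_extChartAt_symm hu
  rw [modelWithCornersSelf_coe, range_id, mfderivWithin_univ] at h
  exact congrArg (fun L : E →L[ℝ] E ↦ L v) h

theorem chartDInv_chartD {x : M} {u : E} (hu : u ∈ (extChartAt 𝓘(ℝ, E) x).target)
    (v : TangentSpace 𝓘(ℝ, E) ((extChartAt 𝓘(ℝ, E) x).symm u)) :
    chartDInv x u (chartD x ((extChartAt 𝓘(ℝ, E) x).symm u) v) = v := by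
  have h := mfderivWithin_extChartAt_symm_comp_mfderiv_extChartAt hu
  rw [modelWithCornersSelf_coe, range_id, mfderivWithin_univ] at h
  exact congrArg (fun L : E →L[ℝ] E ↦ L v) h

theorem chartDInv_self (x : M) (v : E) :
    chartDInv x (extChartAt 𝓘(ℝ, E) x x) v = v := by
  have h := mfderivWithin_range_extChartAt_symm (I := 𝓘(ℝ, E)) (x := x)
  rw [modelWithCornersSelf_coe, range_id, mfderivWithin_univ] at h
  exact congrArg (fun L : E →L[ℝ] E ↦ L v) h

theorem chartDInv_fieldInChart (X : VField E M) {x : M} {u : E}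
    (hu : u ∈ (extChartAt 𝓘(ℝ, E) x).target) :
    chartDInv x u (fieldInChart X x u) = X ((extChartAt 𝓘(ℝ, E) x).symm u) :=
  chartDInv_chartD hu _

theorem fieldInChart_self (X : VField E M) (x : M) :
    fieldInChart X x (extChartAt 𝓘(ℝ, E) x x) = X x := by
  unfold fieldInChart
  rw [extChartAt_to_inv]
  exact chartD_self x _

/-- These coordinate fields are the test vectors on which forms and 2-tensors are evaluated to see
that their chart expressions are smooth. -/
theorem contMDiffOn_chartDInv (x : M) (v : E) :
    ContMDiffOn 𝓘(ℝ, E) (𝓘(ℝ, E).prod 𝓘(ℝ, E)) ∞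
      (fun u : E ↦ TotalSpace.mk' E (E := fun x : M ↦ TangentSpace 𝓘(ℝ, E) x)
        ((extChartAt 𝓘(ℝ, E) x).symm u) (chartDInv x u v)) (extChartAt 𝓘(ℝ, E) x).target := by
  have h1 := (contMDiffOn_extChartAt_symm (I := 𝓘(ℝ, E)) (n := ∞) x).contMDiffOn_tangentMapWithin
    (m := ∞) (by simp) (isOpen_extChartAt_target x).uniqueMDiffOn
  have h2 : ContMDiff 𝓘(ℝ, E) (𝓘(ℝ, E).prod 𝓘(ℝ, E)) ∞
      (fun u : E ↦ TotalSpace.mk' E (E := fun x : E ↦ TangentSpace 𝓘(ℝ, E) x) u v) :=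
    contMDiff_vectorSpace_iff_contDiff.2 contDiff_const
  refine (h1.comp h2.contMDiffOn (fun u hu ↦ hu)).congr fun u hu ↦ ?_
  simp only [Function.comp, tangentMapWithin]
  rw [mfderivWithin_of_isOpen (isOpen_extChartAt_target x) hu]
  rfl

theorem contDiffOn_fieldInChart {X : VField E M} (hX : SmoothVField X) (x : M) :
    ContDiffOn ℝ ∞ (fieldInChart X x) (extChartAt 𝓘(ℝ, E) x).target := by
  have h1 := (contMDiffOn_extChartAt (I := 𝓘(ℝ, E)) (n := ∞) (x := x)).contMDiffOn_tangentMapWithin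
    (m := ∞) (by simp) (chartAt E x).open_source.uniqueMDiffOn
  have h2 := (hX.contMDiffOn (s := univ)).comp
    (contMDiffOn_extChartAt_symm (I := 𝓘(ℝ, E)) (n := ∞) x) (fun _ _ ↦ mem_univ _)
  have h3 := h1.comp h2 (fun u hu ↦ by
    have := (extChartAt 𝓘(ℝ, E) x).map_target hu
    rwa [extChartAt_source] at this)
  have h4 := (contMDiff_snd_tangentBundle_modelSpace E 𝓘(ℝ, E)
    (n := ∞)).comp_contMDiffOn h3
  refine h4.contDiffOn.congr fun u hu ↦ ?_
  simp only [Function.comp, tangentMapWithin]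
  rw [mfderivWithin_of_isOpen (chartAt E x).open_source]
  · rfl
  · have := (extChartAt 𝓘(ℝ, E) x).map_target hu
    rwa [extChartAt_source] at this

theorem contDiffOn_formInChart [FiniteDimensional ℝ E] {η : OneForm E M} (hη : SmoothOneForm η)
    (x : M) : ContDiffOn ℝ ∞ (formInChart η x) (extChartAt 𝓘(ℝ, E) x).target := by
  rw [contDiffOn_clm_apply]
  intro v
  have h1 := (hη.contMDiffOn (s := univ)).comp
    (contMDiffOn_extChartAt_symm (I := 𝓘(ℝ, E)) (n := ∞) x) (fun _ _ ↦ mem_univ _)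
  have h2 := ContMDiffOn.clm_bundle_apply (E₂ := Bundle.Trivial M ℝ) h1 (contMDiffOn_chartDInv x v)
  intro u hu
  have h3 := h2 u hu
  simp only [contMDiffWithinAt_totalSpace] at h3
  exact h3.2.contDiffWithinAt

theorem contDiffOn_tensorInChart [FiniteDimensional ℝ E]
    {g : ∀ x : M, TangentSpace 𝓘(ℝ, E) x →L[ℝ] TangentSpace 𝓘(ℝ, E) x →L[ℝ] ℝ}
    (hg : ContMDiff 𝓘(ℝ, E) (𝓘(ℝ, E).prod 𝓘(ℝ, E →L[ℝ] E →L[ℝ] ℝ)) ∞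
      (fun b ↦ TotalSpace.mk' (E →L[ℝ] E →L[ℝ] ℝ)
        (E := fun b : M ↦ TangentSpace 𝓘(ℝ, E) b →L[ℝ] TangentSpace 𝓘(ℝ, E) b →L[ℝ] ℝ) b (g b)))
    (x : M) : ContDiffOn ℝ ∞ (tensorInChart g x) (extChartAt 𝓘(ℝ, E) x).target := by
  rw [contDiffOn_clm_apply]
  intro v
  rw [contDiffOn_clm_apply]
  intro w
  have h1 := (hg.contMDiffOn (s := univ)).comp
    (contMDiffOn_extChartAt_symm (I := 𝓘(ℝ, E)) (n := ∞) x) (fun _ _ ↦ mem_univ _)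
  have h2 := ContMDiffOn.clm_bundle_apply₂ (E₃ := Bundle.Trivial M ℝ) (F₁ := E) (F₂ := E) h1
    (contMDiffOn_chartDInv x v) (contMDiffOn_chartDInv x w)
  intro u hu
  have h3 := h2 u hu
  simp only [contMDiffWithinAt_totalSpace] at h3
  exact h3.2.contDiffWithinAt

theorem hasMFDerivAt_extChartAt_symm {x : M} {u : E} (hu : u ∈ (extChartAt 𝓘(ℝ, E) x).target) :
    HasMFDerivAt 𝓘(ℝ, E) 𝓘(ℝ, E) (extChartAt 𝓘(ℝ, E) x).symm u (chartDInv x u) :=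
  (((contMDiffOn_extChartAt_symm (I := 𝓘(ℝ, E)) (n := ∞) x).contMDiffAt
    ((isOpen_extChartAt_target x).mem_nhds hu)).mdifferentiableAt (by simp)).hasMFDerivAt

theorem SmoothVField.contMDiff_one {ξ : VField E M} (hξ : SmoothVField ξ) :
    ContMDiff 𝓘(ℝ, E) 𝓘(ℝ, E).tangent 1 (fun x ↦ (⟨x, ξ x⟩ : TangentBundle 𝓘(ℝ, E) M)) :=
  ContMDiff.of_le hξ (by simp)

end Charts

/-! ### Local flows on a manifold -/

section ManifoldFlow

variable {E : Type*} [NormedAddCommGroup E] [NormedSpace ℝ E] [FiniteDimensional ℝ E]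
  {M : Type*} [TopologicalSpace M] [ChartedSpace E M] [IsManifold 𝓘(ℝ, E) ∞ M]

/-- A bump function cuts the field off, because the Banach space result `exists_local_flow` takes a
field defined everywhere. -/
theorem exists_contDiff_eqOn_ball {X : E → E} {s : Set E} (hs : IsOpen s)
    (hX : ContDiffOn ℝ ∞ X s) {u : E} (hu : u ∈ s) :
    ∃ r > 0, ∃ Y : E → E, ContDiff ℝ ∞ Y ∧ Metric.ball u r ⊆ s ∧ EqOn Y X (Metric.ball u r) := by
  obtain ⟨R, hR, hRs⟩ := Metric.nhds_basis_closedBall.mem_iff.1 (hs.mem_nhds hu)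
  let f : ContDiffBump u := ⟨R / 2, R, by positivity, by linarith⟩
  refine ⟨R / 2, by positivity, fun y ↦ f y • X y, ?_, ?_, ?_⟩
  · rw [contDiff_iff_contDiffAt]
    intro y
    by_cases hy : y ∈ s
    · exact f.contDiff.contDiffAt.smul (hX.contDiffAt (hs.mem_nhds hy))
    · have hy' : y ∉ tsupport f := fun h ↦ hy (hRs (by rwa [f.tsupport_eq] at h))
      have : (fun y ↦ f y • X y) =ᶠ[nhds y] fun _ ↦ 0 := by
        filter_upwards [notMem_tsupport_iff_eventuallyEq.1 hy'] with z hz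
        rw [hz, Pi.zero_apply, zero_smul]
      exact contDiffAt_const.congr_of_eventuallyEq this
  · exact (Metric.ball_subset_closedBall.trans
      (Metric.closedBall_subset_closedBall (by linarith))).trans hRs
  · intro y hy
    have : f y = 1 := f.one_of_mem_closedBall (Metric.ball_subset_closedBall hy)
    simp only [this, one_smul]

/-- Local flows of a smooth vector field on a manifold. -/
theorem exists_local_flow_manifold {ξ : VField E M} (hξ : SmoothVField ξ) (x₀ : M) :
    ∃ ε > 0, ∃ V : Set M, IsOpen V ∧ x₀ ∈ V ∧ ∃ Ψ : ℝ × M → M,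
      ContMDiffOn (𝓘(ℝ, ℝ).prod 𝓘(ℝ, E)) 𝓘(ℝ, E) ∞ Ψ (Ioo (-ε) ε ×ˢ V) ∧
      ∀ x ∈ V, Ψ (0, x) = x ∧
        IsMIntegralCurveOn (I := 𝓘(ℝ, E)) (fun s ↦ Ψ (s, x)) ξ (Ioo (-ε) ε) := by
  have : CompleteSpace E := FiniteDimensional.complete ℝ E
  set κ := extChartAt 𝓘(ℝ, E) x₀ with hκ
  obtain ⟨R, hR, X, hX, hRt, hXeq⟩ := exists_contDiff_eqOn_ball (isOpen_extChartAt_target x₀)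
    (contDiffOn_fieldInChart hξ x₀) (mem_extChartAt_target (I := 𝓘(ℝ, E)) x₀)
  obtain ⟨r, hr, ψ, hψ, hψ0, hψ'⟩ := exists_local_flow hX (κ x₀)
  have hopen : IsOpen (Ioo (-r) r ×ˢ Metric.ball (κ x₀) r) := isOpen_Ioo.prod Metric.isOpen_ball
  -- Orbits must remain in the ball where the cut-off field still agrees with `ξ` in the chart.
  have hW : IsOpen (Ioo (-r) r ×ˢ Metric.ball (κ x₀) r ∩ ψ ⁻¹' Metric.ball (κ x₀) R) :=
    hψ.continuousOn.isOpen_inter_preimage hopen Metric.isOpen_ball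
  have hmem : ((0 : ℝ), κ x₀) ∈ Ioo (-r) r ×ˢ Metric.ball (κ x₀) r ∩
      ψ ⁻¹' Metric.ball (κ x₀) R := by
    refine ⟨⟨⟨by linarith, hr⟩, Metric.mem_ball_self hr⟩, ?_⟩
    rw [mem_preimage, hψ0 _ (Metric.mem_ball_self hr)]
    exact Metric.mem_ball_self hR
  obtain ⟨ε, hε, hεW⟩ := Metric.isOpen_iff.1 hW _ hmem
  have hεW' : ∀ s ∈ Ioo (-ε) ε, ∀ u ∈ Metric.ball (κ x₀) ε,
      (s, u) ∈ Ioo (-r) r ×ˢ Metric.ball (κ x₀) r ∩ ψ ⁻¹' Metric.ball (κ x₀) R := by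
    intro s hs u hu
    refine hεW ?_
    rw [← ball_prod_same, Real.ball_eq_Ioo]
    exact ⟨by simpa using hs, hu⟩
  refine ⟨ε, hε, κ.source ∩ κ ⁻¹' Metric.ball (κ x₀) ε,
    (continuousOn_extChartAt x₀).isOpen_inter_preimage (isOpen_extChartAt_source x₀)
      Metric.isOpen_ball, ⟨mem_extChartAt_source x₀, Metric.mem_ball_self hε⟩,
    fun p ↦ κ.symm (ψ (p.1, κ p.2)), ?_, ?_⟩
  · have h1 : ContMDiffOn (𝓘(ℝ, ℝ).prod 𝓘(ℝ, E)) 𝓘(ℝ, ℝ × E) ∞ (fun p : ℝ × M ↦ (p.1, κ p.2))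
        (Ioo (-ε) ε ×ˢ (κ.source ∩ κ ⁻¹' Metric.ball (κ x₀) ε)) := by
      rw [modelWithCornersSelf_prod, ← chartedSpaceSelf_prod]
      refine contMDiffOn_fst.prodMk ((contMDiffOn_extChartAt (I := 𝓘(ℝ, E)) (n := ∞)
        (x := x₀)).comp contMDiffOn_snd ?_)
      rintro ⟨s, y⟩ ⟨-, hy, -⟩
      rw [hκ, extChartAt_source] at hy
      exact hy
    have h2 := hψ.contMDiffOn.comp h1 (fun p hp ↦ (hεW' _ hp.1 _ hp.2.2).1)
    exact (contMDiffOn_extChartAt_symm (I := 𝓘(ℝ, E)) (n := ∞) x₀).comp h2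
      (fun p hp ↦ hRt (hεW' _ hp.1 _ hp.2.2).2)
  · rintro x ⟨hxs, hx⟩
    refine ⟨?_, ?_⟩
    · simp only
      rw [hψ0 _ (hεW' 0 ⟨by linarith, hε⟩ _ hx).1.2, κ.left_inv hxs]
    · intro s hs
      have h := hεW' s hs _ hx
      have ht : ψ (s, κ x) ∈ κ.target := hRt h.2
      have h1 := (hψ' _ h.1.2 s h.1.1).hasFDerivAt.hasMFDerivAt
      have h2 := (hasMFDerivAt_extChartAt_symm ht).comp s h1
      refine HasMFDerivAt.hasMFDerivWithinAt ?_
      refine h2.congr_mfderiv (ContinuousLinearMap.ext fun (c : ℝ) ↦ ?_)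
      have h3 := chartDInv_fieldInChart ξ ht
      rw [← hXeq h.2] at h3
      exact (map_smul (chartDInv x₀ (ψ (s, κ x))) c (X (ψ (s, κ x)))).trans (congrArg (c • ·) h3)

/-- By uniqueness the curve agrees near each time with a translate of an orbit of the smooth local
flow. Being an integral curve is only a pointwise differentiability condition, whereas the length
estimate needs a `C^1` path. -/
theorem contMDiffOn_integralCurve [T2Space M] {ξ : VField E M} (hξ : SmoothVField ξ) {γ : ℝ → M}
    {a b : ℝ} (hγ : IsMIntegralCurveOn (I := 𝓘(ℝ, E)) γ ξ (Ioo a b)) :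
    ContMDiffOn 𝓘(ℝ, ℝ) 𝓘(ℝ, E) ∞ γ (Ioo a b) := by
  have : CompleteSpace E := FiniteDimensional.complete ℝ E
  intro t ht
  obtain ⟨ε, hε, V, hV, hxV, Ψ, hΨ, hΨ'⟩ := exists_local_flow_manifold hξ (γ t)
  obtain ⟨h0, hint⟩ := hΨ' _ hxV
  have h1 : IsMIntegralCurveAt (I := 𝓘(ℝ, E)) ((fun s ↦ Ψ (s, γ t)) ∘ (· - t)) ξ t := by
    have := (isMIntegralCurveAt_comp_sub (dt := t)).2
      (hint.isMIntegralCurveAt (Ioo_mem_nhds (by linarith : -ε < 0) hε))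
    rwa [zero_add] at this
  have heq : γ =ᶠ[nhds t] ((fun s ↦ Ψ (s, γ t)) ∘ (· - t)) :=
    isMIntegralCurveAt_eventuallyEq_of_contMDiffAt_boundaryless hξ.contMDiff_one.contMDiffAt
      (hγ.isMIntegralCurveAt (Ioo_mem_nhds ht.1 ht.2)) h1 (by simp [h0])
  refine ContMDiffAt.contMDiffWithinAt (ContMDiffAt.congr_of_eventuallyEq ?_ heq)
  have h2 : ContMDiffAt (𝓘(ℝ, ℝ).prod 𝓘(ℝ, E)) 𝓘(ℝ, E) ∞ Ψ (t - t, γ t) := by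
    refine hΨ.contMDiffAt ((isOpen_Ioo.prod hV).mem_nhds ⟨?_, hxV⟩)
    rw [sub_self]
    exact ⟨by linarith, hε⟩
  have h3 : ContMDiffAt 𝓘(ℝ, ℝ) (𝓘(ℝ, ℝ).prod 𝓘(ℝ, E)) ∞ (fun s : ℝ ↦ (s - t, γ t)) t :=
    ContMDiffAt.prodMk (contDiff_id.sub contDiff_const).contMDiff.contMDiffAt contMDiffAt_const
  exact ContMDiffAt.comp t (f := fun s : ℝ ↦ (s - t, γ t)) h2 h3

end ManifoldFlow

/-! ### The group law and smoothness of a global flow -/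

section GlobalFlow

variable {E : Type*} [NormedAddCommGroup E] [NormedSpace ℝ E] [FiniteDimensional ℝ E]
  {M : Type*} [TopologicalSpace M] [ChartedSpace E M] [IsManifold 𝓘(ℝ, E) ∞ M] [T2Space M]

/-- As functions of `s`, both sides are integral curves that start at `φ t x`. -/
theorem flow_add {ξ : VField E M} (hξ : SmoothVField ξ) {φ : ℝ → M → M} (h0 : ∀ x, φ 0 x = x)
    (hφ : ∀ x, IsMIntegralCurve (I := 𝓘(ℝ, E)) (fun t ↦ φ t x) ξ) (s t : ℝ) (x : M) :
    φ (s + t) x = φ s (φ t x) := by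
  have : CompleteSpace E := FiniteDimensional.complete ℝ E
  have h := isMIntegralCurve_Ioo_eq_of_contMDiff_boundaryless (t₀ := 0) hξ.contMDiff_one
    ((hφ x).comp_add t) (hφ (φ t x)) (by simp [h0])
  exact congrFun h s

/-- A family of global integral curves depends smoothly on time and initial value. -/
theorem isGlobalFlow_of_isMIntegralCurve {ξ : VField E M} (hξ : SmoothVField ξ) {φ : ℝ → M → M}
    (h0 : ∀ x, φ 0 x = x) (hφ : ∀ x, IsMIntegralCurve (I := 𝓘(ℝ, E)) (fun t ↦ φ t x) ξ) :
    IsGlobalFlow ξ φ := by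
  have : CompleteSpace E := FiniteDimensional.complete ℝ E
  refine ⟨h0, hφ, ?_⟩
  have hlocal : ∀ x₀ : M, ∃ ε > 0, ∃ V : Set M, IsOpen V ∧ x₀ ∈ V ∧
      ContMDiffOn (𝓘(ℝ, ℝ).prod 𝓘(ℝ, E)) 𝓘(ℝ, E) ∞ (fun p : ℝ × M ↦ φ p.1 p.2)
        (Ioo (-ε) ε ×ˢ V) := by
    intro x₀
    obtain ⟨ε, hε, V, hV, hxV, Ψ, hΨ, hΨ'⟩ := exists_local_flow_manifold hξ x₀
    refine ⟨ε, hε, V, hV, hxV, hΨ.congr ?_⟩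
    rintro ⟨s, y⟩ ⟨hs, hy⟩
    exact isMIntegralCurveOn_Ioo_eqOn_of_contMDiff_boundaryless (t₀ := 0) ⟨by linarith, hε⟩
      hξ.contMDiff_one ((hφ y).isMIntegralCurveOn _) (hΨ' y hy).2
      (by rw [h0, (hΨ' y hy).1]) hs
  rintro ⟨t₀, x₀⟩
  -- Connectedness of the time axis: this set of times is shown to be open, closed and nonempty.
  let S : Set ℝ := {t | ContMDiffAt (𝓘(ℝ, ℝ).prod 𝓘(ℝ, E)) 𝓘(ℝ, E) ∞
    (fun p : ℝ × M ↦ φ p.1 p.2) (t, x₀)}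
  -- near any time there is one at which smoothness would propagate
  have hprop : ∀ t : ℝ, ∃ δ > 0, ∀ t₁ ∈ Ioo (t - δ) (t + δ), t₁ ∈ S →
      ∀ t₂ ∈ Ioo (t - δ) (t + δ), t₂ ∈ S := by
    intro t
    obtain ⟨ε, hε, V, hV, hxV, hsm⟩ := hlocal (φ t x₀)
    have hcont : ContinuousAt (fun s ↦ φ s x₀) t := (hφ x₀).continuous.continuousAt
    obtain ⟨δ, hδ, hδV⟩ := Metric.mem_nhds_iff.1 (hcont.preimage_mem_nhds (hV.mem_nhds hxV))
    -- Half of `ε`, so that any two times of the window differ by less than `ε`. The flow near time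
    -- `t₂` is then `φ_{t₁}` followed by the smooth short-time flow near `φ t x₀`.
    refine ⟨min δ (ε / 2), lt_min hδ (by linarith), ?_⟩
    intro t₁ ht₁ hS t₂ ht₂
    have hd1 := min_le_left δ (ε / 2)
    have hd2 := min_le_right δ (ε / 2)
    have h1 : φ t₁ x₀ ∈ V := hδV (by
      rw [Real.ball_eq_Ioo]
      exact ⟨by linarith [ht₁.1], by linarith [ht₁.2]⟩)
    have h2 : ContMDiffAt (𝓘(ℝ, ℝ).prod 𝓘(ℝ, E)) 𝓘(ℝ, E) ∞
        (fun p : ℝ × M ↦ φ p.1 p.2) (t₂ - t₁, φ t₁ x₀) :=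
      hsm.contMDiffAt ((isOpen_Ioo.prod hV).mem_nhds ⟨⟨by linarith [ht₁.2, ht₂.1],
        by linarith [ht₁.1, ht₂.2]⟩, h1⟩)
    have h3 : ContMDiffAt 𝓘(ℝ, E) 𝓘(ℝ, E) ∞ (fun y ↦ φ t₁ y) x₀ :=
      ContMDiffAt.comp x₀ (f := fun y : M ↦ (t₁, y)) hS
        (contMDiffAt_const.prodMk contMDiffAt_id)
    have h4 : ContMDiffAt (𝓘(ℝ, ℝ).prod 𝓘(ℝ, E)) (𝓘(ℝ, ℝ).prod 𝓘(ℝ, E)) ∞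
        (fun p : ℝ × M ↦ (p.1 - t₁, φ t₁ p.2)) (t₂, x₀) :=
      ContMDiffAt.prodMk
        (((contDiff_id.sub contDiff_const).contMDiff.contMDiffAt (x := t₂)).comp (t₂, x₀)
          (f := Prod.fst) contMDiffAt_fst)
        (ContMDiffAt.comp (t₂, x₀) (f := Prod.snd) (g := fun y ↦ φ t₁ y) h3 contMDiffAt_snd)
    have h5 := ContMDiffAt.comp (t₂, x₀) (f := fun p : ℝ × M ↦ (p.1 - t₁, φ t₁ p.2)) h2 h4
    refine h5.congr_of_eventuallyEq (Filter.Eventually.of_forall ?_)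
    rintro ⟨s, y⟩
    simp only [Function.comp]
    rw [← flow_add hξ h0 hφ, sub_add_cancel]
  have hclopen : IsClopen S := by
    constructor
    · refine isClosed_of_closure_subset fun t ht ↦ ?_
      obtain ⟨δ, hδ, h⟩ := hprop t
      obtain ⟨t₁, ht₁, hS⟩ := mem_closure_iff.1 ht (Ioo (t - δ) (t + δ)) isOpen_Ioo
        ⟨by linarith, by linarith⟩
      exact h t₁ ht₁ hS t ⟨by linarith, by linarith⟩
    · refine isOpen_iff_mem_nhds.2 fun t ht ↦ ?_
      obtain ⟨δ, hδ, h⟩ := hprop t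
      filter_upwards [Ioo_mem_nhds (by linarith : t - δ < t) (by linarith : t < t + δ)] with t₂ ht₂
      exact h t ⟨by linarith, by linarith⟩ ht t₂ ht₂
  have h0S : (0 : ℝ) ∈ S := by
    obtain ⟨ε, hε, V, hV, hxV, hsm⟩ := hlocal x₀
    exact hsm.contMDiffAt ((isOpen_Ioo.prod hV).mem_nhds ⟨⟨by linarith, hε⟩, hxV⟩)
  have : S = univ := hclopen.eq_univ ⟨0, h0S⟩
  exact (this ▸ mem_univ t₀ : t₀ ∈ S)

theorem IsGlobalFlow.eq {ξ : VField E M} (hξ : SmoothVField ξ) {φ φ' : ℝ → M → M}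
    (h : IsGlobalFlow ξ φ) (h' : IsGlobalFlow ξ φ') : φ = φ' := by
  have : CompleteSpace E := FiniteDimensional.complete ℝ E
  ext t x
  exact congrFun (isMIntegralCurve_Ioo_eq_of_contMDiff_boundaryless (t₀ := 0) hξ.contMDiff_one
    (h.integralCurve x) (h'.integralCurve x) (by simp only [h.zero, h'.zero])) t

end GlobalFlow

/-! ### Completeness of a unit vector field -/

section Completeness

variable {E : Type*} [NormedAddCommGroup E] [NormedSpace ℝ E] [FiniteDimensional ℝ E]
  {M : Type*} [EMetricSpace M] [ChartedSpace E M] [IsManifold 𝓘(ℝ, E) ∞ M]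
  [RiemannianBundle (fun x : M ↦ TangentSpace 𝓘(ℝ, E) x)]
  [IsRiemannianManifold 𝓘(ℝ, E) M]

/-- The curve has unit speed, so its length between two times is their difference, and length bounds
distance. -/
theorem edist_integralCurve_le {ξ : VField E M} (hξ : SmoothVField ξ)
    (hunit : ∀ x, (inner ℝ (ξ x) (ξ x) : ℝ) = 1) {γ : ℝ → M}
    {a b : ℝ} (hγ : IsMIntegralCurveOn (I := 𝓘(ℝ, E)) γ ξ (Ioo a b)) {s t : ℝ}
    (hs : s ∈ Ioo a b) (ht : t ∈ Ioo a b) : edist (γ s) (γ t) ≤ edist s t := by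
  wlog hst : s ≤ t generalizing s t
  · rw [edist_comm, edist_comm s]
    exact this ht hs (le_of_not_ge hst)
  have hsub : Icc s t ⊆ Ioo a b := fun r hr ↦ ⟨hs.1.trans_le hr.1, hr.2.trans_lt ht.2⟩
  rw [IsRiemannianManifold.out (I := 𝓘(ℝ, E)) (γ s) (γ t)]
  refine (riemannianEDist_le_pathELength (((contMDiffOn_integralCurve hξ hγ).mono hsub).of_le
    (by simp)) rfl rfl hst).trans ?_
  rw [pathELength_eq_lintegral_mfderiv_Icc]
  have hnorm : ∀ r ∈ Icc s t, ‖mfderiv 𝓘(ℝ, ℝ) 𝓘(ℝ, E) γ r 1‖ₑ = 1 := by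
    intro r hr
    have h1 := ((hγ r (hsub hr)).hasMFDerivAt (isOpen_Ioo.mem_nhds (hsub hr))).mfderiv
    have h2 : mfderiv 𝓘(ℝ, ℝ) 𝓘(ℝ, E) γ r 1 = ξ (γ r) := by
      rw [h1]
      exact one_smul ℝ (ξ (γ r))
    rw [h2]
    have h3 : ‖ξ (γ r)‖ = 1 := by
      have := hunit (γ r)
      rw [real_inner_self_eq_norm_sq] at this
      nlinarith [norm_nonneg (ξ (γ r))]
    rw [← ofReal_norm, h3, ENNReal.ofReal_one]
  rw [MeasureTheory.setLIntegral_congr_fun measurableSet_Icc hnorm]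
  simp [edist_dist, Real.dist_eq, abs_sub_comm s t, abs_of_nonneg (sub_nonneg.2 hst)]

variable [CompleteSpace M]

/-- A smooth unit vector field on a complete Riemannian manifold is complete. -/
theorem exists_isMIntegralCurve_of_unit {ξ : VField E M} (hξ : SmoothVField ξ)
    (hunit : ∀ x, (inner ℝ (ξ x) (ξ x) : ℝ) = 1) (x : M) :
    ∃ γ : ℝ → M, γ 0 = x ∧ IsMIntegralCurve (I := 𝓘(ℝ, E)) γ ξ := by
  have : CompleteSpace E := FiniteDimensional.complete ℝ E
  have hξ1 := hξ.contMDiff_one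
  let S : Set ℝ := {a | ∃ γ : ℝ → M, γ 0 = x ∧ IsMIntegralCurveOn (I := 𝓘(ℝ, E)) γ ξ (Ioo (-a) a)}
  suffices hbdd : ¬BddAbove S by
    rw [not_bddAbove_iff] at hbdd
    rw [exists_isMIntegralCurve_iff_exists_isMIntegralCurveOn_Ioo hξ1]
    intro a
    obtain ⟨y, ⟨γ, hγ1, hγ2⟩, hlt⟩ := hbdd a
    exact ⟨γ, hγ1, hγ2.mono <| Ioo_subset_Ioo (neg_le_neg hlt.le) hlt.le⟩
  intro hbdd
  -- The existence time is uniform in a neighbourhood of `p`. This allows restarting from a point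
  -- near a limit point, at a time close to `A`, and passing `A`.
  have hcurve : ∀ p : M, ∃ ε > 0, ∃ V : Set M, IsOpen V ∧ p ∈ V ∧ ∀ q ∈ V, ∃ γ : ℝ → M,
      γ 0 = q ∧ IsMIntegralCurveOn (I := 𝓘(ℝ, E)) γ ξ (Ioo (-ε) ε) := by
    intro p
    obtain ⟨ε, hε, V, hV, hpV, Ψ, -, hΨ⟩ := exists_local_flow_manifold hξ p
    exact ⟨ε, hε, V, hV, hpV, fun q hq ↦ ⟨fun s ↦ Ψ (s, q), hΨ q hq⟩⟩
  obtain ⟨ε₀, hε₀, V₀, -, hxV₀, h₀⟩ := hcurve x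
  have hε₀S : ε₀ ∈ S := h₀ x hxV₀
  set A := sSup S with hA
  have hApos : 0 < A := hε₀.trans_le (le_csSup hbdd hε₀S)
  have hex : ∀ a : ℝ, ∃ γ : ℝ → M, a < A →
      γ 0 = x ∧ IsMIntegralCurveOn (I := 𝓘(ℝ, E)) γ ξ (Ioo (-a) a) := by
    intro a
    by_cases ha : a < A
    · obtain ⟨b, ⟨γ, hγ0, hγ⟩, hab⟩ := exists_lt_of_lt_csSup ⟨ε₀, hε₀S⟩ ha
      exact ⟨γ, fun _ ↦ ⟨hγ0, hγ.mono (Ioo_subset_Ioo (neg_le_neg hab.le) hab.le)⟩⟩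
    · exact ⟨fun _ ↦ x, fun h ↦ absurd h ha⟩
  choose γ hγ using hex
  have hagree : ∀ a b : ℝ, a ≤ b → b < A → EqOn (γ a) (γ b) (Ioo (-a) a) := by
    intro a b hab hb t ht
    have ha0 : 0 < a := by linarith [ht.1, ht.2]
    have ha := hγ a (hab.trans_lt hb)
    have hb' := hγ b hb
    exact isMIntegralCurveOn_Ioo_eqOn_of_contMDiff_boundaryless (t₀ := 0)
      ⟨by linarith, ha0⟩ hξ1 ha.2 (hb'.2.mono (Ioo_subset_Ioo (neg_le_neg hab) hab))
      (ha.1.trans hb'.1.symm) ht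
  -- For `|t| < A` the midpoint of `|t|` and `A` is a radius below `A` whose interval contains `t`;
  -- uniqueness makes the choice irrelevant.
  let Γ : ℝ → M := fun t ↦ γ ((|t| + A) / 2) t
  have hΓ : ∀ a < A, EqOn Γ (γ a) (Ioo (-a) a) := by
    intro a ha t ht
    have hta : |t| < a := abs_lt.2 ht
    have h1 : t ∈ Ioo (-((|t| + A) / 2)) ((|t| + A) / 2) := abs_lt.1 (by linarith)
    rcases le_total ((|t| + A) / 2) a with h | h
    · exact hagree _ _ h ha h1
    · exact (hagree _ _ h (by linarith) ht).symm
  have hΓd : ∀ s t : ℝ, |s| < A → |t| < A → edist (Γ s) (Γ t) ≤ edist s t := by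
    intro s t hs ht
    obtain ⟨a, ha, haA⟩ := exists_between (max_lt hs ht)
    have hs' : s ∈ Ioo (-a) a := abs_lt.1 ((le_max_left _ _).trans_lt ha)
    have ht' : t ∈ Ioo (-a) a := abs_lt.1 ((le_max_right _ _).trans_lt ha)
    rw [hΓ a haA hs', hΓ a haA ht']
    exact edist_integralCurve_le hξ hunit (hγ a haA).2 hs' ht'
  obtain ⟨u, -, hu, hutend⟩ := exists_seq_strictMono_tendsto' hApos
  have hlim : ∀ σ : ℝ, |σ| = 1 → ∃ p : M, Filter.Tendsto (fun n ↦ Γ (σ * u n)) Filter.atTop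
      (nhds p) := by
    intro σ hσ
    refine cauchySeq_tendsto_of_complete (EMetric.cauchySeq_iff.2 fun ε hε ↦ ?_)
    have hc := (hutend.const_mul σ).cauchySeq
    obtain ⟨N, hN⟩ := EMetric.cauchySeq_iff.1 hc ε hε
    refine ⟨N, fun m hm n hn ↦ (hΓd _ _ ?_ ?_).trans_lt (hN m hm n hn)⟩
    · rw [abs_mul, hσ, one_mul, abs_of_pos (hu m).1]
      exact (hu m).2
    · rw [abs_mul, hσ, one_mul, abs_of_pos (hu n).1]
      exact (hu n).2
  obtain ⟨p, hp⟩ := hlim 1 (by simp)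
  obtain ⟨q, hq⟩ := hlim (-1) (by simp)
  simp only [one_mul, neg_one_mul] at hp hq
  obtain ⟨ε₁, hε₁, V₁, hV₁, hpV₁, h₁⟩ := hcurve p
  obtain ⟨ε₂, hε₂, V₂, hV₂, hqV₂, h₂⟩ := hcurve q
  set ε := min ε₁ ε₂ with hε_def
  have hε : 0 < ε := lt_min hε₁ hε₂
  obtain ⟨n, hnp, hnq, hnε⟩ := ((hp.eventually (hV₁.mem_nhds hpV₁)).and
    ((hq.eventually (hV₂.mem_nhds hqV₂)).and
      (hutend.eventually (Ioi_mem_nhds (by linarith : A - ε / 2 < A))))).exists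
  set t := u n with ht
  have htA : t < A := (hu n).2
  have ht0 : 0 < t := (hu n).1
  have hnε' : A - ε / 2 < t := hnε
  obtain ⟨a, hta, haA⟩ := exists_between htA
  obtain ⟨hγ0, hγa⟩ := hγ a haA
  obtain ⟨c₁, hc₁0, hc₁⟩ := h₁ _ hnp
  obtain ⟨c₂, hc₂0, hc₂⟩ := h₂ _ hnq
  replace hc₁ := hc₁.mono (Ioo_subset_Ioo (neg_le_neg (min_le_left ε₁ ε₂)) (min_le_left ε₁ ε₂))
  replace hc₂ := hc₂.mono (Ioo_subset_Ioo (neg_le_neg (min_le_right ε₁ ε₂)) (min_le_right ε₁ ε₂))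
  rw [← hε_def] at hc₁ hc₂
  have hd₁ := (hc₁.comp_add (-t)).mono (s' := Ioo (t - ε) (t + ε))
    fun s hs ↦ (⟨by linarith [hs.1], by linarith [hs.2]⟩ : s + -t ∈ Ioo (-ε) ε)
  have hd₂ := (hc₂.comp_add t).mono (s' := Ioo (-t - ε) (-t + ε))
    fun s hs ↦ (⟨by linarith [hs.1], by linarith [hs.2]⟩ : s + t ∈ Ioo (-ε) ε)
  have he₂ := isMIntegralCurveOn_piecewise (t₀ := -t) hξ1 hγa hd₂
    ⟨⟨by linarith, by linarith⟩, ⟨by linarith, by linarith⟩⟩ (by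
      rw [← hΓ a haA ⟨by linarith, by linarith⟩]
      simp [hc₂0])
  replace he₂ := he₂.mono (s' := Ioo (-t - ε) a) (by
    rw [union_comm]
    exact Ioo_subset_Ioo_union_Ioo le_rfl (by linarith) le_rfl)
  have he₁ := isMIntegralCurveOn_piecewise (t₀ := t) hξ1 he₂ hd₁
    ⟨⟨by linarith, by linarith⟩, ⟨by linarith, by linarith⟩⟩ (by
      rw [piecewise, if_pos (show t ∈ Ioo (-a) a from ⟨by linarith, by linarith⟩),
        ← hΓ a haA ⟨by linarith, by linarith⟩]
      simp [hc₁0])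
  -- The glued curve lives on `(-t - ε, t + ε)`, and `t > A - ε / 2`; this contradicts the choice of
  -- `A` as a supremum.
  have hmem : A + ε / 2 ∈ S := by
    refine ⟨_, ?_, he₁.mono (Ioo_subset_Ioo_union_Ioo (by linarith) (by linarith) (by linarith))⟩
    rw [piecewise, if_pos (show (0 : ℝ) ∈ Ioo (-t - ε) a from ⟨by linarith, by linarith⟩),
      piecewise, if_pos (show (0 : ℝ) ∈ Ioo (-a) a from ⟨by linarith, by linarith⟩), hγ0]
  linarith [le_csSup hbdd hmem]

theorem existsUnique_isGlobalFlow {ξ : VField E M} (hξ : SmoothVField ξ)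
    (hunit : ∀ x, (inner ℝ (ξ x) (ξ x) : ℝ) = 1) : ∃! φ : ℝ → M → M, IsGlobalFlow ξ φ := by
  choose γ hγ0 hγ using exists_isMIntegralCurve_of_unit hξ hunit
  exact ⟨fun t x ↦ γ x t, isGlobalFlow_of_isMIntegralCurve hξ hγ0 hγ,
    fun φ' h' ↦ h'.eq hξ (isGlobalFlow_of_isMIntegralCurve hξ hγ0 hγ)⟩

end Completeness

/-! ### The differential of the flow and its linearization -/

section FlowInChart

variable {E : Type*} [NormedAddCommGroup E] [NormedSpace ℝ E]
  {M : Type*} [TopologicalSpace M] [ChartedSpace E M] [IsManifold 𝓘(ℝ, E) ∞ M]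

theorem IsGlobalFlow.contMDiff {ξ : VField E M} {φ : ℝ → M → M} (hφ : IsGlobalFlow ξ φ) (t : ℝ) :
    ContMDiff 𝓘(ℝ, E) 𝓘(ℝ, E) ∞ (φ t) :=
  hφ.smooth.comp (contMDiff_const.prodMk contMDiff_id)

theorem IsGlobalFlow.mdifferentiableAt {ξ : VField E M} {φ : ℝ → M → M} (hφ : IsGlobalFlow ξ φ)
    (t : ℝ) (x : M) : MDifferentiableAt 𝓘(ℝ, E) 𝓘(ℝ, E) (φ t) x :=
  (hφ.contMDiff t).mdifferentiableAt (by simp)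

theorem hasMFDerivAt_extChartAt_chartD {x y : M} (hy : y ∈ (extChartAt 𝓘(ℝ, E) x).source) :
    HasMFDerivAt 𝓘(ℝ, E) 𝓘(ℝ, E) (extChartAt 𝓘(ℝ, E) x) y (chartD x y) :=
  (mdifferentiableAt_extChartAt (by rwa [extChartAt_source] at hy)).hasMFDerivAt

/-- The expression of a flow in the preferred chart at `x`. -/
def flowInChart (φ : ℝ → M → M) (x : M) (p : ℝ × E) : E :=
  extChartAt 𝓘(ℝ, E) x (φ p.1 ((extChartAt 𝓘(ℝ, E) x).symm p.2))

/-- The set on which the expression of a flow in the preferred chart at `x` is meaningful. -/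
def flowDomain (φ : ℝ → M → M) (x : M) : Set (ℝ × E) :=
  {p | p.2 ∈ (extChartAt 𝓘(ℝ, E) x).target ∧
    φ p.1 ((extChartAt 𝓘(ℝ, E) x).symm p.2) ∈ (extChartAt 𝓘(ℝ, E) x).source}

variable {ξ : VField E M} {φ : ℝ → M → M}

theorem contMDiffOn_flow_extChartAt_symm (hφ : IsGlobalFlow ξ φ) (x : M) :
    ContMDiffOn 𝓘(ℝ, ℝ × E) 𝓘(ℝ, E) ∞
      (fun p : ℝ × E ↦ φ p.1 ((extChartAt 𝓘(ℝ, E) x).symm p.2))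
      (univ ×ˢ (extChartAt 𝓘(ℝ, E) x).target) := by
  have h1 : ContMDiffOn 𝓘(ℝ, ℝ × E) (𝓘(ℝ, ℝ).prod 𝓘(ℝ, E)) ∞
      (fun p : ℝ × E ↦ (p.1, (extChartAt 𝓘(ℝ, E) x).symm p.2))
      (univ ×ˢ (extChartAt 𝓘(ℝ, E) x).target) :=
    contDiff_fst.contMDiff.contMDiffOn.prodMk
      ((contMDiffOn_extChartAt_symm (I := 𝓘(ℝ, E)) (n := ∞) x).comp
        contDiff_snd.contMDiff.contMDiffOn (fun p hp ↦ hp.2))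
  exact (hφ.smooth.contMDiffOn (s := univ)).comp h1 (fun _ _ ↦ mem_univ _)

theorem isOpen_flowDomain (hφ : IsGlobalFlow ξ φ) (x : M) : IsOpen (flowDomain (E := E) φ x) := by
  have h := (contMDiffOn_flow_extChartAt_symm hφ x).continuousOn.isOpen_inter_preimage
    (isOpen_univ.prod (isOpen_extChartAt_target x)) (isOpen_extChartAt_source (I := 𝓘(ℝ, E)) x)
  convert h using 1
  ext p
  simp [flowDomain]

theorem contDiffOn_flowInChart (hφ : IsGlobalFlow ξ φ) (x : M) :
    ContDiffOn ℝ ∞ (flowInChart φ x) (flowDomain (E := E) φ x) := by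
  have hsub : flowDomain (E := E) φ x ⊆ univ ×ˢ (extChartAt 𝓘(ℝ, E) x).target :=
    fun p hp ↦ ⟨mem_univ _, hp.1⟩
  have h := (contMDiffOn_extChartAt (I := 𝓘(ℝ, E)) (n := ∞) (x := x)).comp
    ((contMDiffOn_flow_extChartAt_symm hφ x).mono hsub) (fun p hp ↦ by
        have := hp.2
        rwa [extChartAt_source] at this)
  exact h.contDiffOn

theorem flowInChart_zero (hφ : IsGlobalFlow ξ φ) {x : M} {u : E}
    (hu : u ∈ (extChartAt 𝓘(ℝ, E) x).target) : flowInChart φ x (0, u) = u := by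
  simp only [flowInChart, hφ.zero]
  exact (extChartAt 𝓘(ℝ, E) x).right_inv hu

theorem zero_mem_flowDomain (hφ : IsGlobalFlow ξ φ) {x : M} {u : E}
    (hu : u ∈ (extChartAt 𝓘(ℝ, E) x).target) : ((0 : ℝ), u) ∈ flowDomain φ x := by
  refine ⟨hu, ?_⟩
  simp only [hφ.zero]
  exact (extChartAt 𝓘(ℝ, E) x).map_target hu

theorem hasDerivAt_flowInChart (hφ : IsGlobalFlow ξ φ) {x : M} {t : ℝ} {u : E}
    (h : (t, u) ∈ flowDomain φ x) :
    HasDerivAt (fun s ↦ flowInChart φ x (s, u)) (fieldInChart ξ x (flowInChart φ x (t, u))) t := by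
  set y := φ t ((extChartAt 𝓘(ℝ, E) x).symm u) with hy
  have h1 := (hasMFDerivAt_extChartAt_chartD h.2).comp t
    (hφ.integralCurve ((extChartAt 𝓘(ℝ, E) x).symm u) t)
  have h2 : HasFDerivAt (fun s ↦ flowInChart φ x (s, u))
      (ContinuousLinearMap.toSpanSingleton ℝ (chartD x y (ξ y))) t :=
    hasMFDerivAt_iff_hasFDerivAt.1
      (h1.congr_mfderiv (ContinuousLinearMap.ext fun c : ℝ ↦ map_smul (chartD x y) c (ξ y)))
  have h3 : (extChartAt 𝓘(ℝ, E) x).symm (flowInChart φ x (t, u)) = y :=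
    (extChartAt 𝓘(ℝ, E) x).left_inv h.2
  refine h2.hasDerivAt.congr_deriv ?_
  unfold fieldInChart
  rw [h3]
  exact one_smul ℝ _

/-- The differential of a flow along an orbit, in the preferred chart at its initial point `x`:
it is governed by the linearization of the vector field. -/
theorem exists_mfderiv_flow_eq (hφ : IsGlobalFlow ξ φ) (x : M) :
    ∃ (c : ℝ → E) (Y : ℝ → E →L[ℝ] E), c 0 = extChartAt 𝓘(ℝ, E) x x ∧
      HasDerivAt c (fieldInChart ξ x (extChartAt 𝓘(ℝ, E) x x)) 0 ∧
      Y 0 = .id ℝ E ∧ HasDerivAt Y (fderiv ℝ (fieldInChart ξ x) (extChartAt 𝓘(ℝ, E) x x)) 0 ∧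
      ∀ᶠ t in nhds 0, c t ∈ (extChartAt 𝓘(ℝ, E) x).target ∧
        (extChartAt 𝓘(ℝ, E) x).symm (c t) = φ t x ∧
        ∀ v : E, (mfderiv 𝓘(ℝ, E) 𝓘(ℝ, E) (φ t) x v : E) = (chartDInv x (c t) (Y t v) : E) := by
  set κ := extChartAt 𝓘(ℝ, E) x with hκ
  set Ψ := flowInChart (E := E) φ x with hΨ
  have hx : κ x ∈ κ.target := mem_extChartAt_target x
  have hopen := isOpen_flowDomain hφ x
  have hsm := contDiffOn_flowInChart hφ x
  have h0 := zero_mem_flowDomain hφ hx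
  have hΨat : ContDiffAt ℝ ∞ Ψ (0, κ x) := hsm.contDiffAt (hopen.mem_nhds h0)
  let inr : E →L[ℝ] ℝ × E := ContinuousLinearMap.inr ℝ ℝ E
  let D2 := fderiv ℝ (fderiv ℝ Ψ) (0, κ x)
  have hD2 : HasFDerivAt (fderiv ℝ Ψ) D2 (0, κ x) :=
    ((hΨat.fderiv_right (m := ∞) (by simp)).differentiableAt (by simp)).hasFDerivAt
  -- Symmetry of the second derivative exchanges time and space: the time derivative of the
  -- differential of the flow is the space derivative of its velocity, that is, of the vector field.
  have hsymm : ∀ v w, D2 v w = D2 w v := fun v w ↦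
    (hΨat.isSymmSndFDerivAt (by simpa using WithTop.coe_le_coe.2 (le_top (a := (2 : ℕ∞))))) v w
  have htime : HasDerivAt (fun t : ℝ ↦ (t, κ x)) ((1 : ℝ), (0 : E)) 0 :=
    (hasDerivAt_id 0).prodMk (hasDerivAt_const 0 _)
  refine ⟨fun t ↦ Ψ (t, κ x), fun t ↦ (fderiv ℝ Ψ (t, κ x)).comp inr, flowInChart_zero hφ hx,
    ?_, ?_, ?_, ?_⟩
  · have := hasDerivAt_flowInChart hφ h0
    rwa [flowInChart_zero hφ hx] at this
  · have h1 : HasFDerivAt (fun u ↦ Ψ (0, u)) ((fderiv ℝ Ψ (0, κ x)).comp inr) (κ x) :=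
      (hΨat.differentiableAt (by simp)).hasFDerivAt.comp (κ x) (hasFDerivAt_prodMk_right 0 (κ x))
    refine h1.unique ((hasFDerivAt_id (κ x)).congr_of_eventuallyEq ?_)
    filter_upwards [(isOpen_extChartAt_target x).mem_nhds hx] with u hu
    exact flowInChart_zero hφ hu
  · have h1 : HasDerivAt (fun t ↦ fderiv ℝ Ψ (t, κ x)) (D2 (1, 0)) 0 :=
      HasFDerivAt.comp_hasDerivAt (f := fun t : ℝ ↦ (t, κ x)) 0 hD2 htime
    have h2 := h1.clm_comp (hasDerivAt_const (0 : ℝ) inr)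
    refine h2.congr_deriv ?_
    have h3 : HasFDerivAt (fun u ↦ fderiv ℝ Ψ (0, u) (1, 0))
        ((ContinuousLinearMap.apply ℝ E ((1 : ℝ), (0 : E))).comp (D2.comp inr)) (κ x) :=
      (ContinuousLinearMap.apply ℝ E ((1 : ℝ), (0 : E))).hasFDerivAt.comp (κ x)
        (HasFDerivAt.comp (f := fun u : E ↦ ((0 : ℝ), u)) (κ x) hD2
          (hasFDerivAt_prodMk_right 0 (κ x)))
    have h4 : HasFDerivAt (fieldInChart ξ x)
        ((ContinuousLinearMap.apply ℝ E ((1 : ℝ), (0 : E))).comp (D2.comp inr)) (κ x) := by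
      refine h3.congr_of_eventuallyEq ?_
      filter_upwards [(isOpen_extChartAt_target x).mem_nhds hx] with u hu
      have h0u := zero_mem_flowDomain hφ hu
      have h5 : HasDerivAt (fun s ↦ Ψ (s, u)) (fderiv ℝ Ψ (0, u) (1, 0)) 0 :=
        HasFDerivAt.comp_hasDerivAt (f := fun t : ℝ ↦ (t, u)) 0
          ((hsm.contDiffAt (hopen.mem_nhds h0u)).differentiableAt (by simp)).hasFDerivAt
          ((hasDerivAt_id 0).prodMk (hasDerivAt_const 0 _))
      have h6 := hasDerivAt_flowInChart hφ h0u
      rw [flowInChart_zero hφ hu] at h6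
      exact h6.unique h5
    rw [h4.fderiv]
    ext v
    simpa [inr] using hsymm (1, 0) (0, v)
  · have hcont : Filter.Tendsto (fun t : ℝ ↦ (t, κ x)) (nhds 0) (nhds (0, κ x)) :=
      htime.continuousAt
    filter_upwards [hcont.eventually (hopen.mem_nhds h0)] with t ht
    have hsrc : φ t (κ.symm (κ x)) ∈ κ.source := ht.2
    have htarget : Ψ (t, κ x) ∈ κ.target := κ.map_source hsrc
    have hinv : κ.symm (κ x) = x := extChartAt_to_inv x
    refine ⟨htarget, ?_, fun v ↦ ?_⟩
    · refine (κ.left_inv hsrc).trans ?_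
      rw [hinv]
    · have h1 := hasMFDerivAt_extChartAt_chartD (mem_extChartAt_source (I := 𝓘(ℝ, E)) x)
      have h2 : HasFDerivAt (fun u ↦ Ψ (t, u)) ((fderiv ℝ Ψ (t, κ x)).comp inr) (κ x) :=
        ((hsm.contDiffAt (hopen.mem_nhds ht)).differentiableAt (by simp)).hasFDerivAt.comp (κ x)
          (hasFDerivAt_prodMk_right t (κ x))
      have h3 := (hasMFDerivAt_extChartAt_symm htarget).comp x (h2.hasMFDerivAt.comp x h1)
      have h4 : φ t =ᶠ[nhds x] κ.symm ∘ ((fun u ↦ Ψ (t, u)) ∘ κ) := by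
        have hc : ContinuousAt (φ t) x := (hφ.contMDiff t).continuous.continuousAt
        rw [hinv] at hsrc
        filter_upwards [(isOpen_extChartAt_source (I := 𝓘(ℝ, E)) x).mem_nhds
          (mem_extChartAt_source x),
          hc.eventually ((isOpen_extChartAt_source (I := 𝓘(ℝ, E)) x).mem_nhds hsrc)] with y hy hy'
        simp only [Function.comp, hΨ, flowInChart]
        rw [(extChartAt 𝓘(ℝ, E) x).left_inv hy]
        exact ((extChartAt 𝓘(ℝ, E) x).left_inv hy').symm
      have h5 := (h3.congr_of_eventuallyEq h4).mfderiv
      refine (congrArg (fun L : E →L[ℝ] E ↦ L v) h5).trans ?_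
      exact congrArg (fun w ↦ chartDInv x (Ψ (t, κ x)) ((fderiv ℝ Ψ (t, κ x)).comp inr w))
        (chartD_self x v)

end FlowInChart

/-! ### Invariance of the contact form and of its exterior derivative -/

section InvariantTensors

variable {E : Type*} [NormedAddCommGroup E] [NormedSpace ℝ E]
  {M : Type*} [TopologicalSpace M] [ChartedSpace E M]

/-- All tangent spaces unfold to the model space `E`, so vectors over two propositionally equal base
points can be compared as elements of `E`. -/
theorem form_apply_congr (η : OneForm E M) {y y' : M} (h : y = y') {v v' : E} (hv : v = v') :
    (η y v : ℝ) = η y' v' := by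
  subst h hv
  rfl

theorem tensor_apply_congr
    (g : ∀ x : M, TangentSpace 𝓘(ℝ, E) x →L[ℝ] TangentSpace 𝓘(ℝ, E) x →L[ℝ] ℝ)
    {y y' : M} (h : y = y') {v v' w w' : E} (hv : v = v') (hw : w = w') :
    (g y v w : ℝ) = g y' v' w' := by
  subst h hv hw
  rfl

theorem tensorInChart_self
    (g : ∀ x : M, TangentSpace 𝓘(ℝ, E) x →L[ℝ] TangentSpace 𝓘(ℝ, E) x →L[ℝ] ℝ)
    [IsManifold 𝓘(ℝ, E) ∞ M] (x : M) (v w : E) :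
    tensorInChart g x (extChartAt 𝓘(ℝ, E) x x) v w = g x v w := by
  rw [tensorInChart_apply]
  exact tensor_apply_congr g (extChartAt_to_inv x) (chartDInv_self x v) (chartDInv_self x w)

variable [IsManifold 𝓘(ℝ, E) ∞ M]

theorem dForm_eq (η : OneForm E M) (x : M) (v w : E) :
    dForm η x v w = fderiv ℝ (formInChart η x) (extChartAt 𝓘(ℝ, E) x x) v w
      - fderiv ℝ (formInChart η x) (extChartAt 𝓘(ℝ, E) x x) w v := by
  have h : ∀ v : E, (mfderiv 𝓘(ℝ, E) 𝓘(ℝ, E) (extChartAt 𝓘(ℝ, E) x) x v : E) = v := chartD_self x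
  unfold dForm
  simp only [h]

variable {ξ : VField E M} {φ : ℝ → M → M}

theorem mfderiv_flow_zero (hφ : IsGlobalFlow ξ φ) (x : M) (v : E) :
    (mfderiv 𝓘(ℝ, E) 𝓘(ℝ, E) (φ 0) x v : E) = v := by
  have : φ 0 = id := funext hφ.zero
  rw [this, mfderiv_id]
  rfl

section Add

variable [FiniteDimensional ℝ E] [T2Space M]

theorem mfderiv_flow_add (hξ : SmoothVField ξ) (hφ : IsGlobalFlow ξ φ) (s t : ℝ) (x : M) (v : E) :
    (mfderiv 𝓘(ℝ, E) 𝓘(ℝ, E) (φ (s + t)) x v : E) =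
      mfderiv 𝓘(ℝ, E) 𝓘(ℝ, E) (φ s) (φ t x) (mfderiv 𝓘(ℝ, E) 𝓘(ℝ, E) (φ t) x v) := by
  have h : φ (s + t) = φ s ∘ φ t := funext (flow_add hξ hφ.zero hφ.integralCurve s t)
  rw [h, mfderiv_comp x (hφ.mdifferentiableAt s _) (hφ.mdifferentiableAt t x)]
  rfl

theorem mfderiv_flow_surjective (hξ : SmoothVField ξ) (hφ : IsGlobalFlow ξ φ) (t : ℝ) (x : M)
    (w : E) : ∃ v : E, (mfderiv 𝓘(ℝ, E) 𝓘(ℝ, E) (φ t) x v : E) = w := by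
  have hx : φ (-t) (φ t x) = x := by
    rw [← flow_add hξ hφ.zero hφ.integralCurve, neg_add_cancel, hφ.zero]
  have h := mfderiv_flow_add hξ hφ t (-t) (φ t x) w
  rw [add_neg_cancel, mfderiv_flow_zero hφ, hx] at h
  exact ⟨_, h.symm⟩

/-- A tensor field is invariant under a flow if its derivative along the flow vanishes at
time `0`. -/
theorem flow_invariant_of_hasDerivAt_zero (hξ : SmoothVField ξ) (hφ : IsGlobalFlow ξ φ)
    (G : M → E → E → ℝ)
    (hG : ∀ x (v w : E), HasDerivAt (fun t ↦ G (φ t x) (mfderiv 𝓘(ℝ, E) 𝓘(ℝ, E) (φ t) x v)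
      (mfderiv 𝓘(ℝ, E) 𝓘(ℝ, E) (φ t) x w)) 0 0) (t : ℝ) (x : M) (v w : E) :
    G (φ t x) (mfderiv 𝓘(ℝ, E) 𝓘(ℝ, E) (φ t) x v) (mfderiv 𝓘(ℝ, E) 𝓘(ℝ, E) (φ t) x w)
      = G x v w := by
  let F : ℝ → ℝ := fun t ↦ G (φ t x) (mfderiv 𝓘(ℝ, E) 𝓘(ℝ, E) (φ t) x v)
    (mfderiv 𝓘(ℝ, E) 𝓘(ℝ, E) (φ t) x w)
  have hF : ∀ t, HasDerivAt F 0 t := by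
    intro t
    -- The group law turns the derivative at time `t` along the orbit of `x` into the derivative at
    -- time `0` along the orbit of `φ t x`.
    have h1 := hG (φ t x) (mfderiv 𝓘(ℝ, E) 𝓘(ℝ, E) (φ t) x v)
      (mfderiv 𝓘(ℝ, E) 𝓘(ℝ, E) (φ t) x w)
    simp only [← mfderiv_flow_add hξ hφ, ← flow_add hξ hφ.zero hφ.integralCurve] at h1
    have h2 : HasDerivAt (fun s ↦ F (s + t)) 0 (t - t) := by
      rw [sub_self]
      exact h1
    simpa using h2.comp_sub_const t t
  have h3 : F t = F 0 := is_const_of_deriv_eq_zero (fun t ↦ (hF t).differentiableAt)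
    (fun t ↦ (hF t).deriv) t 0
  have h4 : ∀ (y : M) (a b : E), y = x → a = v → b = w → G y a b = G x v w := by
    rintro _ _ _ rfl rfl rfl
    rfl
  exact h3.trans (h4 _ _ _ (hφ.zero x) (mfderiv_flow_zero hφ x v) (mfderiv_flow_zero hφ x w))

/-- The flow of a vector field preserves the vector field. -/
theorem mfderiv_flow_apply_self (hξ : SmoothVField ξ) (hφ : IsGlobalFlow ξ φ) (t : ℝ) (x : M) :
    (mfderiv 𝓘(ℝ, E) 𝓘(ℝ, E) (φ t) x (ξ x) : E) = ξ (φ t x) := by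
  have h0 : HasMFDerivAt 𝓘(ℝ, ℝ) 𝓘(ℝ, E) (fun s ↦ φ s x) 0
      ((1 : ℝ →L[ℝ] ℝ).smulRight (ξ (φ 0 x))) := hφ.integralCurve x 0
  have h1 := (hφ.mdifferentiableAt t (φ 0 x)).hasMFDerivAt.comp 0 h0
  have h2 := ((hφ.integralCurve x).comp_add t) 0
  have h3 : (φ t ∘ fun s ↦ φ s x) = (fun s ↦ φ s x) ∘ (· + t) := by
    ext s
    simp only [Function.comp]
    rw [← flow_add hξ hφ.zero hφ.integralCurve, add_comm]
  rw [h3] at h1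
  have h4 := congrArg (fun L : ℝ →L[ℝ] E ↦ L 1) (hasMFDerivAt_unique h1 h2)
  have h5 : (mfderiv 𝓘(ℝ, E) 𝓘(ℝ, E) (φ t) (φ 0 x) ((1 : ℝ) • ξ (φ 0 x)) : E)
      = (1 : ℝ) • (ξ (φ (0 + t) x) : E) := h4
  rwa [one_smul, one_smul, zero_add, hφ.zero] at h5

end Add

/-- Cartan's formula in the chart at `x`. The product rule gives `(L_ξ η)(v)` as `Dη(ξ)v + η(Dξ v)`.
Differentiating `η(ξ) = 1` in the direction `v` replaces the second term by `-Dη(v)ξ`, and what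
results is `dη(ξ, v) = 0`. -/
theorem hasDerivAt_form_flow [FiniteDimensional ℝ E] {η : OneForm E M} (hη : SmoothOneForm η)
    (hξ : SmoothVField ξ) (hreeb : IsReebField η ξ) (hφ : IsGlobalFlow ξ φ) (x : M) (v : E) :
    HasDerivAt (fun t ↦ (η (φ t x) (mfderiv 𝓘(ℝ, E) 𝓘(ℝ, E) (φ t) x v) : ℝ)) 0 0 := by
  obtain ⟨c, Y, hc0, hc, hY0, hY, hev⟩ := exists_mfderiv_flow_eq hφ x
  set κ := extChartAt 𝓘(ℝ, E) x with hκ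
  have hx : κ x ∈ κ.target := mem_extChartAt_target x
  have hnhds := (isOpen_extChartAt_target (I := 𝓘(ℝ, E)) x).mem_nhds hx
  have hA : HasFDerivAt (formInChart η x) (fderiv ℝ (formInChart η x) (κ x)) (κ x) :=
    (((contDiffOn_formInChart hη x).contDiffAt hnhds).differentiableAt (by simp)).hasFDerivAt
  have hX : HasFDerivAt (fieldInChart ξ x) (fderiv ℝ (fieldInChart ξ x) (κ x)) (κ x) :=
    (((contDiffOn_fieldInChart hξ x).contDiffAt hnhds).differentiableAt (by simp)).hasFDerivAt
  have h1 : HasDerivAt (fun t ↦ formInChart η x (c t) (Y t v))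
      (fderiv ℝ (formInChart η x) (κ x) (fieldInChart ξ x (κ x)) v
        + formInChart η x (κ x) (fderiv ℝ (fieldInChart ξ x) (κ x) v)) 0 := by
    rw [← hc0] at hA
    have := (hA.comp_hasDerivAt 0 hc).clm_apply (hY.clm_apply (hasDerivAt_const 0 v))
    simpa [hc0, hY0] using this
  have h2 : ∀ w : E, fderiv ℝ (formInChart η x) (κ x) w (fieldInChart ξ x (κ x))
      + formInChart η x (κ x) (fderiv ℝ (fieldInChart ξ x) (κ x) w) = 0 := by
    intro w
    have h3 := hA.clm_apply hX
    have h4 : HasFDerivAt (fun u ↦ formInChart η x u (fieldInChart ξ x u)) (0 : E →L[ℝ] ℝ)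
        (κ x) := by
      refine (hasFDerivAt_const (1 : ℝ) (κ x)).congr_of_eventuallyEq ?_
      filter_upwards [hnhds] with u hu
      rw [formInChart_apply, chartDInv_fieldInChart ξ hu]
      exact (hreeb _).1
    have h5 := congrArg (fun L : E →L[ℝ] ℝ ↦ L w) (h3.unique h4)
    simp at h5
    linarith
  have h6 : (0 : ℝ) = fderiv ℝ (formInChart η x) (κ x) (fieldInChart ξ x (κ x)) v
        + formInChart η x (κ x) (fderiv ℝ (fieldInChart ξ x) (κ x) v) := by
    have h7 := (dForm_eq η x (ξ x) v).symm.trans ((hreeb x).2 v)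
    have h8 : fieldInChart ξ x (κ x) = (ξ x : E) := fieldInChart_self ξ x
    have h9 := h2 v
    rw [h8] at h9 ⊢
    linarith
  refine HasDerivAt.congr_deriv (h1.congr_of_eventuallyEq ?_) h6.symm
  filter_upwards [hev] with t ht
  rw [formInChart_apply]
  exact form_apply_congr η ht.2.1.symm (ht.2.2 v)

/-- The Reeb flow preserves the contact form. -/
theorem form_mfderiv_flow [FiniteDimensional ℝ E] [T2Space M] {η : OneForm E M}
    (hη : SmoothOneForm η) (hξ : SmoothVField ξ) (hreeb : IsReebField η ξ)
    (hφ : IsGlobalFlow ξ φ) (t : ℝ) (x : M) (v : E) :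
    (η (φ t x) (mfderiv 𝓘(ℝ, E) 𝓘(ℝ, E) (φ t) x v) : ℝ) = η x v :=
  flow_invariant_of_hasDerivAt_zero hξ hφ (fun x v _ ↦ η x v)
    (fun x v _ ↦ hasDerivAt_form_flow hη hξ hreeb hφ x v) t x v 0

/-- A smooth map that preserves a 1-form preserves its exterior derivative. -/
theorem dForm_mfderiv_of_preserves [FiniteDimensional ℝ E] {η : OneForm E M}
    (hη : SmoothOneForm η) {f : M → M} (hf : ContMDiff 𝓘(ℝ, E) 𝓘(ℝ, E) ∞ f)
    (hpres : ∀ (y : M) (v : E), (η (f y) (mfderiv 𝓘(ℝ, E) 𝓘(ℝ, E) f y v) : ℝ) = η y v)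
    (x : M) (v w : E) :
    dForm η (f x) (mfderiv 𝓘(ℝ, E) 𝓘(ℝ, E) f x v) (mfderiv 𝓘(ℝ, E) 𝓘(ℝ, E) f x w)
      = dForm η x v w := by
  set κ := extChartAt 𝓘(ℝ, E) x with hκ
  set κ' := extChartAt 𝓘(ℝ, E) (f x) with hκ'
  have hx : κ x ∈ κ.target := mem_extChartAt_target x
  have hinv : κ.symm (κ x) = x := extChartAt_to_inv x
  let D : Set E := κ.target ∩ (f ∘ κ.symm) ⁻¹' κ'.source
  have hfκ : ContMDiffOn 𝓘(ℝ, E) 𝓘(ℝ, E) ∞ (f ∘ κ.symm) κ.target :=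
    (hf.contMDiffOn (s := univ)).comp (contMDiffOn_extChartAt_symm x) (fun _ _ ↦ mem_univ _)
  have hD : IsOpen D := hfκ.continuousOn.isOpen_inter_preimage (isOpen_extChartAt_target x)
    (isOpen_extChartAt_source (f x))
  have hxD : κ x ∈ D := ⟨hx, by
    simp only [mem_preimage, Function.comp, hinv]
    exact mem_extChartAt_source (f x)⟩
  let Θ : E → E := κ' ∘ f ∘ κ.symm
  have hΘ : ContDiffOn ℝ ∞ Θ D := by
    refine ContMDiffOn.contDiffOn ((contMDiffOn_extChartAt (I := 𝓘(ℝ, E)) (n := ∞)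
      (x := f x)).comp (hfκ.mono inter_subset_left) fun u hu ↦ ?_)
    have := hu.2
    rw [hκ', extChartAt_source] at this
    exact this
  have hΘx : Θ (κ x) = κ' (f x) := by simp only [Θ, Function.comp, hinv]
  have hΘD : ∀ u ∈ D, HasFDerivAt Θ (fderiv ℝ Θ u) u := fun u hu ↦
    ((hΘ.contDiffAt (hD.mem_nhds hu)).differentiableAt (by simp)).hasFDerivAt
  have hrel : ∀ u ∈ D, ∀ w : E, κ'.symm (Θ u) = f (κ.symm u) ∧
      (chartDInv (f x) (Θ u) (fderiv ℝ Θ u w) : E)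
        = mfderiv 𝓘(ℝ, E) 𝓘(ℝ, E) f (κ.symm u) (chartDInv x u w) := by
    intro u hu w
    refine ⟨κ'.left_inv hu.2, ?_⟩
    have h1 := (hasMFDerivAt_extChartAt_symm (κ'.map_source hu.2)).comp u
      (hΘD u hu).hasMFDerivAt
    have h2 := (hf.mdifferentiableAt (by simp) (x := κ.symm u)).hasMFDerivAt.comp u
      (hasMFDerivAt_extChartAt_symm hu.1)
    have h3 := h2.congr_of_eventuallyEq (f₁ := κ'.symm ∘ Θ) (by
      filter_upwards [hD.mem_nhds hu] with z hz
      exact κ'.left_inv hz.2)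
    exact congrArg (fun L : E →L[ℝ] E ↦ L w) (hasMFDerivAt_unique h1 h3)
  have hdf : ∀ w : E, fderiv ℝ Θ (κ x) w = (mfderiv 𝓘(ℝ, E) 𝓘(ℝ, E) f x w : E) := by
    intro w
    have h1 := (hrel _ hxD w).2
    rw [chartDInv_self, hΘx, hinv] at h1
    exact (chartDInv_self (f x) _).symm.trans h1
  have hA : ∀ u ∈ D, ∀ w, formInChart η x u w = formInChart η (f x) (Θ u) (fderiv ℝ Θ u w) := by
    intro u hu w
    exact (hpres _ _).symm.trans
      (form_apply_congr η (hrel u hu w).1.symm (hrel u hu w).2.symm)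
  have hA1 : HasFDerivAt (formInChart η x) (fderiv ℝ (formInChart η x) (κ x)) (κ x) :=
    (((contDiffOn_formInChart hη x).contDiffAt
      ((isOpen_extChartAt_target x).mem_nhds hx)).differentiableAt (by simp)).hasFDerivAt
  have hA2 : HasFDerivAt (formInChart η (f x))
      (fderiv ℝ (formInChart η (f x)) (κ' (f x))) (Θ (κ x)) := by
    rw [hΘx]
    exact (((contDiffOn_formInChart hη (f x)).contDiffAt
      ((isOpen_extChartAt_target (f x)).mem_nhds (mem_extChartAt_target (f x)))).differentiableAt
        (by simp)).hasFDerivAt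
  have hΘx' : ContDiffAt ℝ ∞ Θ (κ x) := hΘ.contDiffAt (hD.mem_nhds hxD)
  have hΘ2 : HasFDerivAt (fderiv ℝ Θ) (fderiv ℝ (fderiv ℝ Θ) (κ x)) (κ x) :=
    ((hΘx'.fderiv_right (m := ∞) (by simp)).differentiableAt (by simp)).hasFDerivAt
  have hsymm : ∀ v w, fderiv ℝ (fderiv ℝ Θ) (κ x) v w = fderiv ℝ (fderiv ℝ Θ) (κ x) w v :=
    fun v w ↦ (hΘx'.isSymmSndFDerivAt
      (by simpa using WithTop.coe_le_coe.2 (le_top (a := (2 : ℕ∞))))) v w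
  -- The chain rule for the pullback by `Θ`. The term with the second derivative of `Θ` is symmetric
  -- in `v`, `w`, so it drops out of the antisymmetrization.
  have hkey : ∀ v w : E, fderiv ℝ (formInChart η x) (κ x) v w =
      fderiv ℝ (formInChart η (f x)) (κ' (f x)) (fderiv ℝ Θ (κ x) v) (fderiv ℝ Θ (κ x) w)
        + formInChart η (f x) (κ' (f x)) (fderiv ℝ (fderiv ℝ Θ) (κ x) v w) := by
    intro v w
    have h1 := hA1.clm_apply (hasFDerivAt_const w (κ x))
    have h2 := (hA2.comp (κ x) (hΘD _ hxD)).clm_apply (hΘ2.clm_apply (hasFDerivAt_const w (κ x)))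
    have h3 := h2.congr_of_eventuallyEq (f₁ := fun u ↦ formInChart η x u w) (by
      filter_upwards [hD.mem_nhds hxD] with u hu
      exact hA u hu w)
    have h4 := congrArg (fun L : E →L[ℝ] ℝ ↦ L v) (h1.unique h3)
    simp [hΘx] at h4
    linarith
  refine (dForm_eq η (f x) _ _).trans (Eq.trans ?_ (dForm_eq η x v w).symm)
  have h3 := hdf v
  have h4 := hdf w
  refine Eq.trans (b := fderiv ℝ (formInChart η (f x)) (κ' (f x)) (fderiv ℝ Θ (κ x) v)
    (fderiv ℝ Θ (κ x) w) - fderiv ℝ (formInChart η (f x)) (κ' (f x)) (fderiv ℝ Θ (κ x) w)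
    (fderiv ℝ Θ (κ x) v)) (by rw [h3, h4]) ?_
  have h1 := hkey v w
  have h2 := hkey w v
  rw [hsymm w v] at h2
  linarith

end InvariantTensors

/-! ### Product rules for bilinear forms evaluated along maps -/

section BilinearCalculus

variable {D E F : Type*} [NormedAddCommGroup D] [NormedSpace ℝ D] [NormedAddCommGroup E] [NormedSpace ℝ E]
  [NormedAddCommGroup F] [NormedSpace ℝ F]
theorem hasFDerivAt_bilin_apply {B : E → E →L[ℝ] F} {c V : D → E} {B' : E →L[ℝ] E →L[ℝ] F}
    {c' V' : D →L[ℝ] E} {t : D}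
   (hB : HasFDerivAt B B' (c t)) (hc : HasFDerivAt c c' t) (hV : HasFDerivAt V V' t) :
   HasFDerivAt (fun s => B (c s) (V s)) ((B (c t)).comp V' + (B'.comp c').flip (V t)) t := by
  exact (hB.comp t hc).clm_apply hV

-- The derivative is given only through its values, which is all that later computations use, and
-- this avoids carrying a large operator expression.
set_option synthInstance.maxHeartbeats 200000 in
theorem hasFDerivAt_bilin_apply_apply {B : E → E →L[ℝ] E →L[ℝ] ℝ} {c V W : D → E} {B' : E →L[ℝ] E →L[ℝ] E →L[ℝ] ℝ}
    {c' V' W' : D →L[ℝ] E} {t : D}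
   (hB : HasFDerivAt B B' (c t)) (hc : HasFDerivAt c c' t) (hV : HasFDerivAt V V' t) (hW : HasFDerivAt W W' t) :
   ∃ L : D →L[ℝ] ℝ, HasFDerivAt (fun s => B (c s) (V s) (W s)) L t ∧
    ∀ d, L d = B' (c' d) (V t) (W t) + B (c t) (V' d) (W t) + B (c t) (V t) (W' d) := by
  have h1 := hasFDerivAt_bilin_apply (F := E →L[ℝ] ℝ) hB hc hV
  have h2 := HasFDerivAt.clm_apply (G := E) (H := ℝ) h1 hW
  refine ⟨_, h2, fun d ↦ ?_⟩
  change B (c t) (V t) (W' d) + (B (c t) (V' d) (W t) + B' (c' d) (V t) (W t)) = _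
  ring
end BilinearCalculus

/-! ### The Lie derivative of the metric and Killing fields -/

section Killing

variable {E : Type*} [NormedAddCommGroup E] [NormedSpace ℝ E]
  {M : Type*} [TopologicalSpace M] [ChartedSpace E M] [IsManifold 𝓘(ℝ, E) ∞ M]

theorem mpullbackWithin_extChartAt_symm (X : VField E M) {x : M} {u : E}
    (hu : u ∈ (extChartAt 𝓘(ℝ, E) x).target) :
    (VectorField.mpullbackWithin 𝓘(ℝ, E) 𝓘(ℝ, E) (extChartAt 𝓘(ℝ, E) x).symm X
      (range 𝓘(ℝ, E)) u : E) = fieldInChart X x u := by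
  rw [VectorField.mpullbackWithin_apply, modelWithCornersSelf_coe, range_id, mfderivWithin_univ]
  have h : ContinuousLinearMap.inverse
      (mfderiv 𝓘(ℝ, E) 𝓘(ℝ, E) (extChartAt 𝓘(ℝ, E) x).symm u)
        = chartD x ((extChartAt 𝓘(ℝ, E) x).symm u) :=
    ContinuousLinearMap.inverse_eq (ContinuousLinearMap.ext fun v ↦ chartDInv_chartD hu v)
      (ContinuousLinearMap.ext fun v ↦ chartD_chartDInv hu v)
  rw [h]
  rfl

/-- The preferred chart at `x` has identity differential at `x`, so the pulled back bracket needs no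
correction by the chart. -/
theorem mlieBracket_eq_inChart (X V : VField E M) (x : M) :
    (VectorField.mlieBracket 𝓘(ℝ, E) X V x : E) =
      fderiv ℝ (fieldInChart V x) (extChartAt 𝓘(ℝ, E) x x)
          (fieldInChart X x (extChartAt 𝓘(ℝ, E) x x))
        - fderiv ℝ (fieldInChart X x) (extChartAt 𝓘(ℝ, E) x x)
          (fieldInChart V x (extChartAt 𝓘(ℝ, E) x x)) := by
  have hx : extChartAt 𝓘(ℝ, E) x x ∈ (extChartAt 𝓘(ℝ, E) x).target := mem_extChartAt_target x
  have hnhds := (isOpen_extChartAt_target (I := 𝓘(ℝ, E)) x).mem_nhds hx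
  have hpb : ∀ W : VField E M, (fun u ↦ (VectorField.mpullbackWithin 𝓘(ℝ, E) 𝓘(ℝ, E)
      (extChartAt 𝓘(ℝ, E) x).symm W (range 𝓘(ℝ, E)) u : E))
        =ᶠ[nhds (extChartAt 𝓘(ℝ, E) x x)] fieldInChart W x := fun W ↦ by
    filter_upwards [hnhds] with u hu
    exact mpullbackWithin_extChartAt_symm W hu
  have h1 : (VectorField.mlieBracket 𝓘(ℝ, E) X V x : E) =
      (ContinuousLinearMap.inverse (R := ℝ) (M := E) (M₂ := E) (chartD x x) : E →L[ℝ] E)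
        (VectorField.lieBracketWithin (E := E) ℝ
          (fun u ↦ (VectorField.mpullbackWithin 𝓘(ℝ, E) 𝓘(ℝ, E)
            (extChartAt 𝓘(ℝ, E) x).symm X (range 𝓘(ℝ, E)) u : E))
          (fun u ↦ (VectorField.mpullbackWithin 𝓘(ℝ, E) 𝓘(ℝ, E)
            (extChartAt 𝓘(ℝ, E) x).symm V (range 𝓘(ℝ, E)) u : E)) univ
              (extChartAt 𝓘(ℝ, E) x x)) := by
    have h := VectorField.mlieBracketWithin_apply (I := 𝓘(ℝ, E)) (V := X) (W := V) (s := univ)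
      (x₀ := x)
    rw [VectorField.mlieBracketWithin_univ] at h
    refine h.trans ?_
    rw [preimage_univ, univ_inter]
    rw [show range 𝓘(ℝ, E) = univ by rw [modelWithCornersSelf_coe, range_id]]
    rfl
  have h2 : (chartD x x : E →L[ℝ] E) = ContinuousLinearMap.id ℝ E :=
    ContinuousLinearMap.ext fun v ↦ chartD_self x v
  have h3 : ContinuousLinearMap.inverse (ContinuousLinearMap.id ℝ E) = ContinuousLinearMap.id ℝ E :=
    ContinuousLinearMap.inverse_id
  refine h1.trans ((congrArg (fun L : E →L[ℝ] E ↦ ContinuousLinearMap.inverse L _) h2).trans ?_)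
  rw [h3]
  exact (congrFun (VectorField.lieBracketWithin_univ (𝕜 := ℝ) (E := E)) _).trans
    (Filter.EventuallyEq.lieBracket_vectorField_eq (hpb X) (hpb V))

/-- The Lie derivative at `x` of a covariant 2-tensor `g` along `ξ`, in the preferred chart
at `x`. -/
def lieDerivInChart
    (g : ∀ x : M, TangentSpace 𝓘(ℝ, E) x →L[ℝ] TangentSpace 𝓘(ℝ, E) x →L[ℝ] ℝ)
    (ξ : VField E M) (x : M) (v w : E) : ℝ :=
  fderiv ℝ (tensorInChart g x) (extChartAt 𝓘(ℝ, E) x x)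
      (fieldInChart ξ x (extChartAt 𝓘(ℝ, E) x x)) v w
    + tensorInChart g x (extChartAt 𝓘(ℝ, E) x x)
      (fderiv ℝ (fieldInChart ξ x) (extChartAt 𝓘(ℝ, E) x x) v) w
    + tensorInChart g x (extChartAt 𝓘(ℝ, E) x x) v
      (fderiv ℝ (fieldInChart ξ x) (extChartAt 𝓘(ℝ, E) x x) w)

theorem hasFDerivAt_fieldInChart {X : VField E M} (hX : SmoothVField X) (x : M) :
    HasFDerivAt (fieldInChart X x) (fderiv ℝ (fieldInChart X x) (extChartAt 𝓘(ℝ, E) x x))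
      (extChartAt 𝓘(ℝ, E) x x) :=
  (((contDiffOn_fieldInChart hX x).contDiffAt ((isOpen_extChartAt_target x).mem_nhds
    (mem_extChartAt_target x))).differentiableAt (by simp)).hasFDerivAt

variable [FiniteDimensional ℝ E]
  {g : ∀ x : M, TangentSpace 𝓘(ℝ, E) x →L[ℝ] TangentSpace 𝓘(ℝ, E) x →L[ℝ] ℝ}

set_option synthInstance.maxHeartbeats 200000 in
theorem hasFDerivAt_tensorInChart
    (hg : ContMDiff 𝓘(ℝ, E) (𝓘(ℝ, E).prod 𝓘(ℝ, E →L[ℝ] E →L[ℝ] ℝ)) ∞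
      (fun b ↦ TotalSpace.mk' (E →L[ℝ] E →L[ℝ] ℝ)
        (E := fun b : M ↦ TangentSpace 𝓘(ℝ, E) b →L[ℝ] TangentSpace 𝓘(ℝ, E) b →L[ℝ] ℝ) b (g b)))
    (x : M) : HasFDerivAt (tensorInChart g x)
      (fderiv ℝ (tensorInChart g x) (extChartAt 𝓘(ℝ, E) x x)) (extChartAt 𝓘(ℝ, E) x x) :=
  (((contDiffOn_tensorInChart hg x).contDiffAt ((isOpen_extChartAt_target x).mem_nhds
    (mem_extChartAt_target x))).differentiableAt (by simp)).hasFDerivAt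

/-- The product rule along the orbit: the base point moves with velocity `ξ`, and by
`exists_mfderiv_flow_eq` the transported vectors move by the linearization of `ξ`. -/
theorem hasDerivAt_tensor_flow
    (hg : ContMDiff 𝓘(ℝ, E) (𝓘(ℝ, E).prod 𝓘(ℝ, E →L[ℝ] E →L[ℝ] ℝ)) ∞
      (fun b ↦ TotalSpace.mk' (E →L[ℝ] E →L[ℝ] ℝ)
        (E := fun b : M ↦ TangentSpace 𝓘(ℝ, E) b →L[ℝ] TangentSpace 𝓘(ℝ, E) b →L[ℝ] ℝ) b (g b)))
    {ξ : VField E M} {φ : ℝ → M → M} (hφ : IsGlobalFlow ξ φ) (x : M) (v w : E) :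
    HasDerivAt (fun t ↦ (g (φ t x) (mfderiv 𝓘(ℝ, E) 𝓘(ℝ, E) (φ t) x v)
      (mfderiv 𝓘(ℝ, E) 𝓘(ℝ, E) (φ t) x w) : ℝ)) (lieDerivInChart g ξ x v w) 0 := by
  obtain ⟨c, Y, hc0, hc, hY0, hY, hev⟩ := exists_mfderiv_flow_eq hφ x
  have hB := hasFDerivAt_tensorInChart hg x
  have h1 : HasDerivAt (fun t ↦ tensorInChart g x (c t) (Y t v) (Y t w))
      (lieDerivInChart g ξ x v w) 0 := by
    rw [← hc0] at hB
    have hYv : ∀ v : E, HasDerivAt (fun t ↦ Y t v)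
        (fderiv ℝ (fieldInChart ξ x) (extChartAt 𝓘(ℝ, E) x x) v) 0 := fun v ↦ by
      simpa using hY.clm_apply (hasDerivAt_const 0 v)
    obtain ⟨L, hL, hL'⟩ := hasFDerivAt_bilin_apply_apply hB hc.hasFDerivAt (hYv v).hasFDerivAt
      (hYv w).hasFDerivAt
    refine hL.hasDerivAt.congr_deriv ?_
    rw [hL']
    simp [hc0, hY0, lieDerivInChart]
  refine h1.congr_of_eventuallyEq ?_
  filter_upwards [hev] with t ht
  rw [tensorInChart_apply]
  exact tensor_apply_congr g ht.2.1.symm (ht.2.2 v) (ht.2.2 w)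

/-- A tangent vector extends to a smooth vector field. -/
theorem exists_smoothVField_apply_eq [T2Space M] (x : M) (v : E) :
    ∃ V : VField E M, SmoothVField V ∧ (V x : E) = v := by
  obtain ⟨s, hs, hext⟩ := FiberBundle.exists_contMDiffOn_extend (k := ∞) 𝓘(ℝ, E) E
    (V := fun x : M ↦ TangentSpace 𝓘(ℝ, E) x) (x₀ := x) v
  obtain ⟨u, hus, hu, hxu⟩ := mem_nhds_iff.1 hs
  obtain ⟨ψ, -, hψ⟩ := (SmoothBumpFunction.nhds_basis_tsupport (I := 𝓘(ℝ, E)) x).mem_iff.1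
    (hu.mem_nhds hxu)
  refine ⟨_, ContMDiffOn.smul_section_of_tsupport (ψ := ψ) ψ.contMDiff.contMDiffOn hu hψ
    (hext.mono hus), ?_⟩
  have h1 : ψ x = 1 := ψ.eq_one
  have h2 : FiberBundle.extend E (E := fun x : M ↦ TangentSpace 𝓘(ℝ, E) x) (x := x) v x = v :=
    FiberBundle.extend_apply_self ..
  change (ψ x • (FiberBundle.extend E (E := fun x : M ↦ TangentSpace 𝓘(ℝ, E) x) (x := x) v x : E)
    : E) = v
  rw [h1, one_smul]
  exact h2

variable [RiemannianBundle (fun x : M ↦ TangentSpace 𝓘(ℝ, E) x)]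

/-- The derivatives of `V` and `W` along `ξ` that come from `ξ(g(V,W))` cancel those in the
brackets. What remains depends on `V` and `W` only through their values at `x`. -/
theorem lieDerivMetric_eq
    (hg : ContMDiff 𝓘(ℝ, E) (𝓘(ℝ, E).prod 𝓘(ℝ, E →L[ℝ] E →L[ℝ] ℝ)) ∞
      (fun b ↦ TotalSpace.mk' (E →L[ℝ] E →L[ℝ] ℝ)
        (E := fun b : M ↦ TangentSpace 𝓘(ℝ, E) b →L[ℝ] TangentSpace 𝓘(ℝ, E) b →L[ℝ] ℝ) b (g b)))
    (hinner : ∀ (x : M) (v w : TangentSpace 𝓘(ℝ, E) x), inner ℝ v w = g x v w)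
    (ξ : VField E M) {V W : VField E M} (hV : SmoothVField V) (hW : SmoothVField W) (x : M) :
    lieDerivMetric ξ V W x = lieDerivInChart g ξ x (V x) (W x) := by
  have hB := hasFDerivAt_tensorInChart hg x
  have hV' := hasFDerivAt_fieldInChart hV x
  have hW' := hasFDerivAt_fieldInChart hW x
  have hξx : fieldInChart ξ x (extChartAt 𝓘(ℝ, E) x x) = (ξ x : E) := fieldInChart_self ξ x
  have hVx : fieldInChart V x (extChartAt 𝓘(ℝ, E) x x) = (V x : E) := fieldInChart_self V x
  have hWx : fieldInChart W x (extChartAt 𝓘(ℝ, E) x x) = (W x : E) := fieldInChart_self W x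
  obtain ⟨L, hL, hL'⟩ := hasFDerivAt_bilin_apply_apply (c := id) hB (hasFDerivAt_id _) hV' hW'
  have hdg : (mfderiv 𝓘(ℝ, E) 𝓘(ℝ, ℝ) (fun y ↦ (inner ℝ (V y) (W y) : ℝ)) x (ξ x) : ℝ)
      = L (ξ x : E) := by
    have h1 := hL.hasMFDerivAt.comp x
      (mdifferentiableAt_extChartAt (I := 𝓘(ℝ, E)) (mem_chart_source E x)).hasMFDerivAt
    have h2 := h1.congr_of_eventuallyEq (f₁ := fun y ↦ (inner ℝ (V y) (W y) : ℝ)) (by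
      filter_upwards [extChartAt_source_mem_nhds (I := 𝓘(ℝ, E)) x] with y hy
      have hu := (extChartAt 𝓘(ℝ, E) x).map_source hy
      have hy' := (extChartAt 𝓘(ℝ, E) x).left_inv hy
      refine (hinner y _ _).trans ?_
      simp only [Function.comp, id]
      rw [tensorInChart_apply, chartDInv_fieldInChart V hu, chartDInv_fieldInChart W hu, hy'])
    have h3 := congrArg (fun L : E →L[ℝ] ℝ ↦ L (ξ x : E)) h2.mfderiv
    exact h3.trans (congrArg L (chartD_self x (ξ x)))
  have hBx := tensorInChart_self g x
  have hb1 : (inner ℝ (VectorField.mlieBracket 𝓘(ℝ, E) ξ V x) (W x) : ℝ) = _ :=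
    (hinner x _ _).trans ((hBx _ _).symm.trans (congrArg
      (fun a : E ↦ tensorInChart g x (extChartAt 𝓘(ℝ, E) x x) a (W x))
      (mlieBracket_eq_inChart ξ V x)))
  have hb2 : (inner ℝ (V x) (VectorField.mlieBracket 𝓘(ℝ, E) ξ W x) : ℝ) = _ :=
    (hinner x _ _).trans ((hBx _ _).symm.trans (congrArg
      (fun a : E ↦ tensorInChart g x (extChartAt 𝓘(ℝ, E) x x) (V x) a)
      (mlieBracket_eq_inChart ξ W x)))
  have key : ∀ a p q : E, a = fieldInChart ξ x (extChartAt 𝓘(ℝ, E) x x) →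
      p = fieldInChart V x (extChartAt 𝓘(ℝ, E) x x) →
      q = fieldInChart W x (extChartAt 𝓘(ℝ, E) x x) →
      L a - tensorInChart g x (extChartAt 𝓘(ℝ, E) x x)
          (fderiv ℝ (fieldInChart V x) (extChartAt 𝓘(ℝ, E) x x)
            (fieldInChart ξ x (extChartAt 𝓘(ℝ, E) x x))
          - fderiv ℝ (fieldInChart ξ x) (extChartAt 𝓘(ℝ, E) x x)
            (fieldInChart V x (extChartAt 𝓘(ℝ, E) x x))) q
        - tensorInChart g x (extChartAt 𝓘(ℝ, E) x x) p
          (fderiv ℝ (fieldInChart W x) (extChartAt 𝓘(ℝ, E) x x)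
            (fieldInChart ξ x (extChartAt 𝓘(ℝ, E) x x))
          - fderiv ℝ (fieldInChart ξ x) (extChartAt 𝓘(ℝ, E) x x)
            (fieldInChart W x (extChartAt 𝓘(ℝ, E) x x)))
      = lieDerivInChart g ξ x p q := by
    rintro _ _ _ rfl rfl rfl
    rw [hL', map_sub, map_sub, sub_apply]
    simp only [lieDerivInChart, id, ContinuousLinearMap.id_apply]
    ring
  exact (congrArg₂ (fun a b : ℝ ↦ a - b) (congrArg₂ (fun a b : ℝ ↦ a - b) hdg hb1) hb2).trans
    (key _ _ _ hξx.symm hVx.symm hWx.symm)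

/-- The flow of a vector field acts by isometries if the metric has vanishing derivative along the
flow at time `0`. -/
theorem isIsometricFlow_of_hasDerivAt_zero [T2Space M] {ξ : VField E M} {φ : ℝ → M → M}
    (hξ : SmoothVField ξ) (hφ : IsGlobalFlow ξ φ)
    (h : ∀ (x : M) (v w : TangentSpace 𝓘(ℝ, E) x),
      HasDerivAt (fun t ↦ (inner ℝ (mfderiv 𝓘(ℝ, E) 𝓘(ℝ, E) (φ t) x v)
        (mfderiv 𝓘(ℝ, E) 𝓘(ℝ, E) (φ t) x w) : ℝ)) 0 0) :
    IsIsometricFlow (E := E) φ := fun t x v w ↦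
  flow_invariant_of_hasDerivAt_zero hξ hφ
    (fun x v w ↦ (@inner ℝ (TangentSpace 𝓘(ℝ, E) x) _ v w : ℝ)) h t x v w

variable [IsContMDiffRiemannianBundle 𝓘(ℝ, E) ∞ E (fun x : M ↦ TangentSpace 𝓘(ℝ, E) x)]

/-- A vector field is Killing if and only if its flow acts by isometries. -/
theorem isKilling_iff_isIsometricFlow [T2Space M] {ξ : VField E M} {φ : ℝ → M → M}
    (hξ : SmoothVField ξ) (hφ : IsGlobalFlow ξ φ) :
    IsKilling ξ ↔ IsIsometricFlow (E := E) φ := by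
  obtain ⟨g, hg, hinner⟩ := IsContMDiffRiemannianBundle.exists_contMDiff (IB := 𝓘(ℝ, E)) (n := ∞)
    (F := E) (E := fun x : M ↦ TangentSpace 𝓘(ℝ, E) x)
  have hd := fun x v w ↦ hasDerivAt_tensor_flow hg hφ x v w
  constructor
  · intro h
    refine isIsometricFlow_of_hasDerivAt_zero hξ hφ fun x v w ↦ ?_
    obtain ⟨V, hV, hVx⟩ := exists_smoothVField_apply_eq (E := E) x v
    obtain ⟨W, hW, hWx⟩ := exists_smoothVField_apply_eq (E := E) x w
    have h1 : lieDerivInChart g ξ x v w = 0 := by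
      rw [← hVx, ← hWx]
      exact (lieDerivMetric_eq hg hinner ξ hV hW x).symm.trans (h V W hV hW x)
    refine HasDerivAt.congr_deriv ?_ h1
    exact (hd x v w).congr_of_eventuallyEq (Filter.Eventually.of_forall fun t ↦ hinner _ _ _)
  · intro h V W hV hW x
    refine (lieDerivMetric_eq hg hinner ξ hV hW x).trans ?_
    refine (hd x (V x) (W x)).unique ?_
    refine (hasDerivAt_const 0 (inner ℝ (V x) (W x) : ℝ)).congr_of_eventuallyEq
      (Filter.Eventually.of_forall fun t ↦ ?_)
    exact (hinner _ _ _).symm.trans (h t x _ _)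

end Killing

/-! ### Isometric flows, invariance of `Φ` and invariance of `J` -/

section ContactMetric

variable {E : Type*} [NormedAddCommGroup E] [NormedSpace ℝ E]
  {M : Type*} [TopologicalSpace M] [ChartedSpace E M] [IsManifold 𝓘(ℝ, E) ∞ M]

theorem dForm_swap (η : OneForm E M) (x : M) (v w : E) : dForm η x v w = -dForm η x w v := by
  have h1 := dForm_eq η x v w
  have h2 := dForm_eq η x w v
  linarith

theorem dForm_sub_right (η : OneForm E M) (x : M) (v w w' : E) :
    dForm η x v (w - w' : E) = dForm η x v w - dForm η x v w' := by
  have h1 := dForm_eq η x v w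
  have h2 := dForm_eq η x v w'
  have h3 := dForm_eq η x v (w - w')
  simp only [map_sub, sub_apply] at h3
  linarith

variable [RiemannianBundle (fun x : M ↦ TangentSpace 𝓘(ℝ, E) x)]

namespace ContactMetricStructure

variable (S : ContactMetricStructure E M)

theorem inner_eq (x : M) (v w : TangentSpace 𝓘(ℝ, E) x) :
    inner ℝ v w = dForm S.η x v (S.Φ x w) + S.η x v * S.η x w :=
  S.metric_eq x v w

theorem inner_ξ_left (x : M) (w : TangentSpace 𝓘(ℝ, E) x) : inner ℝ (S.ξ x) w = S.η x w := by
  rw [S.inner_eq, (S.reeb x).2, (S.reeb x).1, zero_add, one_mul]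

theorem inner_ξ_ξ (x : M) : inner ℝ (S.ξ x) (S.ξ x) = (1 : ℝ) := by
  rw [S.inner_ξ_left, (S.reeb x).1]

theorem η_Φ (x : M) (v : TangentSpace 𝓘(ℝ, E) x) : S.η x (S.Φ x v) = 0 :=
  (S.J x (horizontalProj S.η S.ξ S.reeb x v)).2

theorem coe_horizontalProj (x : M) (v : TangentSpace 𝓘(ℝ, E) x) :
    (horizontalProj S.η S.ξ S.reeb x v : TangentSpace 𝓘(ℝ, E) x) = v - S.η x v • S.ξ x := rfl

theorem horizontalProj_coe (x : M) (v : (S.η x).ker) :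
    horizontalProj S.η S.ξ S.reeb x v = v := by
  refine Subtype.ext ?_
  have h : S.η x v = 0 := v.2
  rw [S.coe_horizontalProj, h, zero_smul, sub_zero]

theorem Φ_coe (x : M) (v : (S.η x).ker) : S.Φ x v = S.J x v :=
  congrArg (fun w ↦ (S.J x w : TangentSpace 𝓘(ℝ, E) x)) (S.horizontalProj_coe x v)

variable [FiniteDimensional ℝ E] [T2Space M] {S} {φ : ℝ → M → M}

theorem η_mfderiv_flow (hφ : IsGlobalFlow S.ξ φ) (t : ℝ) (x : M) (v : TangentSpace 𝓘(ℝ, E) x) :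
    S.η (φ t x) (mfderiv 𝓘(ℝ, E) 𝓘(ℝ, E) (φ t) x v) = S.η x v :=
  form_mfderiv_flow S.smooth_η S.smooth_ξ S.reeb hφ t x v

theorem dη_mfderiv_flow (hφ : IsGlobalFlow S.ξ φ) (t : ℝ) (x : M)
    (v w : TangentSpace 𝓘(ℝ, E) x) :
    dForm S.η (φ t x) (mfderiv 𝓘(ℝ, E) 𝓘(ℝ, E) (φ t) x v)
      (mfderiv 𝓘(ℝ, E) 𝓘(ℝ, E) (φ t) x w) = dForm S.η x v w :=
  dForm_mfderiv_of_preserves S.smooth_η (hφ.contMDiff t) (η_mfderiv_flow hφ t) x v w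

theorem isIsometricFlow_of_preservesEnd (hφ : IsGlobalFlow S.ξ φ) (h : PreservesEnd φ S.Φ) :
    IsIsometricFlow (E := E) φ := by
  intro t x v w
  rw [S.inner_eq, S.inner_eq, η_mfderiv_flow hφ, η_mfderiv_flow hφ, ← h, dη_mfderiv_flow hφ]

/-- Let `a = dφ_t(Φv)` and `b = Φ(dφ_t v)`. Invariance of `g`, `η` and `dη` gives `dη(w,a) =
dη(w,b)` for `w` in the image of `dφ_t`, which is everything. As `a - b` lies in `ker η`,
nondegeneracy of `dη` there forces `a = b`. -/
theorem preservesEnd_of_isIsometricFlow (hφ : IsGlobalFlow S.ξ φ)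
    (h : IsIsometricFlow (E := E) φ) : PreservesEnd φ S.Φ := by
  intro t x v
  set a : TangentSpace 𝓘(ℝ, E) (φ t x) := mfderiv 𝓘(ℝ, E) 𝓘(ℝ, E) (φ t) x (S.Φ x v) with ha'
  set b : TangentSpace 𝓘(ℝ, E) (φ t x) :=
    S.Φ (φ t x) (mfderiv 𝓘(ℝ, E) 𝓘(ℝ, E) (φ t) x v) with hb'
  have ha : S.η (φ t x) a = 0 := (η_mfderiv_flow hφ t x _).trans (S.η_Φ x v)
  have hb : S.η (φ t x) b = 0 := S.η_Φ _ _
  have hab : ∀ w : TangentSpace 𝓘(ℝ, E) (φ t x),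
      dForm S.η (φ t x) w a = dForm S.η (φ t x) w b := by
    intro w
    obtain ⟨u, rfl⟩ : ∃ u : TangentSpace 𝓘(ℝ, E) x, mfderiv 𝓘(ℝ, E) 𝓘(ℝ, E) (φ t) x u = w :=
      mfderiv_flow_surjective S.smooth_ξ hφ t x w
    have h1 := h t x u v
    rw [S.inner_eq, S.inner_eq, η_mfderiv_flow hφ, η_mfderiv_flow hφ] at h1
    exact (dη_mfderiv_flow hφ t x u (S.Φ x v)).trans (add_right_cancel h1).symm
  refine sub_eq_zero.1 ((S.contact (φ t x)).2 (a - b) ?_ fun w _ ↦ ?_)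
  · rw [LinearMap.mem_ker]
    refine (map_sub (S.η (φ t x)) a b).trans ?_
    rw [ha, hb, sub_zero]
  · refine (dForm_swap S.η _ _ _).trans ?_
    rw [neg_eq_zero]
    refine (dForm_sub_right S.η _ w a b).trans ?_
    exact sub_eq_zero.2 (hab w)

theorem preservesHorizontalEnd_of_preservesEnd (hφ : IsGlobalFlow S.ξ φ)
    (h : PreservesEnd φ S.Φ) : PreservesHorizontalEnd φ S.η S.J := by
  intro t x v
  have hv : mfderiv 𝓘(ℝ, E) 𝓘(ℝ, E) (φ t) x (v : TangentSpace 𝓘(ℝ, E) x) ∈ (S.η (φ t x)).ker :=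
    (η_mfderiv_flow hφ t x v).trans v.2
  refine ⟨hv, ?_⟩
  rw [← S.Φ_coe, ← S.Φ_coe]
  exact h t x v

/-- The flow preserves both `η` and `ξ`, so its differential commutes with the projection onto `ker
η`, and `Φ` is `J` after that projection. -/
theorem preservesEnd_of_preservesHorizontalEnd (hφ : IsGlobalFlow S.ξ φ)
    (h : PreservesHorizontalEnd φ S.η S.J) : PreservesEnd φ S.Φ := by
  intro t x v
  obtain ⟨hmem, hJ⟩ := h t x (horizontalProj S.η S.ξ S.reeb x v)
  refine hJ.trans ?_
  refine congrArg (fun w ↦ (S.J (φ t x) w : TangentSpace 𝓘(ℝ, E) (φ t x))) (Subtype.ext ?_)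
  have h1 : mfderiv 𝓘(ℝ, E) 𝓘(ℝ, E) (φ t) x (S.ξ x) = S.ξ (φ t x) :=
    mfderiv_flow_apply_self S.smooth_ξ hφ t x
  refine Eq.trans ?_ (S.coe_horizontalProj _ _).symm
  refine (congrArg (mfderiv 𝓘(ℝ, E) 𝓘(ℝ, E) (φ t) x) (S.coe_horizontalProj x v)).trans ?_
  rw [map_sub, map_smul, η_mfderiv_flow hφ, h1]

end ContactMetricStructure

end ContactMetric

/-! ### From bundle-like metrics to isometric flows -/

section BundleLike

variable {E : Type*} [NormedAddCommGroup E] [NormedSpace ℝ E]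
  {M : Type*} [TopologicalSpace M] [ChartedSpace E M] [IsManifold 𝓘(ℝ, E) ∞ M]
  {F : Type*} [NormedAddCommGroup F] [NormedSpace ℝ F]

/-- A map whose differential vanishes on `ξ` is constant along the flow of `ξ`. -/
theorem apply_flow_eq_of_mfderiv_eq_zero {ξ : VField E M} {φ : ℝ → M → M}
    (hφ : IsGlobalFlow ξ φ) {f : M → F} {U : Set M} (hU : IsOpen U)
    (hf : ContMDiffOn 𝓘(ℝ, E) 𝓘(ℝ, F) ∞ f U)
    (hker : ∀ y ∈ U, (mfderiv 𝓘(ℝ, E) 𝓘(ℝ, F) f y (ξ y) : F) = 0) {ε : ℝ} {y : M}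
    (hy : ∀ s ∈ Ioo (-ε) ε, φ s y ∈ U) {s : ℝ} (hs : s ∈ Ioo (-ε) ε) : f (φ s y) = f y := by
  have hd : ∀ s ∈ Ioo (-ε) ε, HasDerivAt (fun s ↦ f (φ s y)) 0 s := by
    intro s hs
    have h1 := ((hf.contMDiffAt (hU.mem_nhds (hy s hs))).mdifferentiableAt
      (by simp)).hasMFDerivAt.comp s (hφ.integralCurve y s)
    have h2 : HasFDerivAt (fun s ↦ f (φ s y)) (ContinuousLinearMap.toSpanSingleton ℝ
        (mfderiv 𝓘(ℝ, E) 𝓘(ℝ, F) f (φ s y) (ξ (φ s y)) : F)) s :=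
      hasMFDerivAt_iff_hasFDerivAt.1
        (h1.congr_mfderiv (ContinuousLinearMap.ext fun c : ℝ ↦
          map_smul (mfderiv 𝓘(ℝ, E) 𝓘(ℝ, F) f (φ s y)) c (ξ (φ s y))))
    exact h2.hasDerivAt.congr_deriv ((one_smul ℝ _).trans (hker _ (hy s hs)))
  have h0 : (0 : ℝ) ∈ Ioo (-ε) ε := by
    constructor <;> linarith [hs.1, hs.2]
  have h := isOpen_Ioo.is_const_of_deriv_eq_zero isPreconnected_Ioo
    (fun s hs ↦ (hd s hs).differentiableAt.differentiableWithinAt) (fun s hs ↦ (hd s hs).deriv) hs h0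
  exact h.trans (congrArg f (hφ.zero y))

/-- For small `s` the orbits of a whole neighbourhood of `x` stay in `U`, so `f ∘ φ s = f` holds
near `x` and may be differentiated there. -/
theorem eventually_mfderiv_comp_flow_eq {ξ : VField E M} {φ : ℝ → M → M}
    (hφ : IsGlobalFlow ξ φ) {f : M → F} {U : Set M} (hU : IsOpen U)
    (hf : ContMDiffOn 𝓘(ℝ, E) 𝓘(ℝ, F) ∞ f U)
    (hker : ∀ y ∈ U, (mfderiv 𝓘(ℝ, E) 𝓘(ℝ, F) f y (ξ y) : F) = 0) {x : M} (hx : x ∈ U) :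
    ∀ᶠ s in nhds (0 : ℝ), φ s x ∈ U ∧ f (φ s x) = f x ∧ ∀ v : E,
      (mfderiv 𝓘(ℝ, E) 𝓘(ℝ, F) f (φ s x) (mfderiv 𝓘(ℝ, E) 𝓘(ℝ, E) (φ s) x v) : F) =
        mfderiv 𝓘(ℝ, E) 𝓘(ℝ, F) f x v := by
  have h1 : {p : ℝ × M | φ p.1 p.2 ∈ U} ∈ nhds ((0 : ℝ), x) :=
    hφ.smooth.continuous.continuousAt.preimage_mem_nhds (hU.mem_nhds (by
      simpa only [hφ.zero] using hx))
  obtain ⟨A, hA, N, hN, hAN⟩ := mem_nhds_prod_iff.1 h1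
  obtain ⟨ε, hε, hεA⟩ := Metric.mem_nhds_iff.1 hA
  rw [Real.ball_eq_Ioo, zero_sub, zero_add] at hεA
  filter_upwards [Ioo_mem_nhds (neg_lt_zero.2 hε) hε] with s hs
  have hmem : ∀ y ∈ N, ∀ s ∈ Ioo (-ε) ε, φ s y ∈ U := fun y hy s hs ↦
    hAN (mk_mem_prod (hεA hs) hy)
  have hxN := mem_of_mem_nhds hN
  refine ⟨hmem x hxN s hs, apply_flow_eq_of_mfderiv_eq_zero hφ hU hf hker (hmem x hxN) hs,
    fun v ↦ ?_⟩
  have h2 := ((hf.contMDiffAt (hU.mem_nhds (hmem x hxN s hs))).mdifferentiableAt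
      (by simp)).hasMFDerivAt.comp x (hφ.mdifferentiableAt s x).hasMFDerivAt
  have h3 := ((hf.contMDiffAt (hU.mem_nhds hx)).mdifferentiableAt
      (by simp)).hasMFDerivAt.congr_of_eventuallyEq (f₁ := f ∘ φ s) (by
    filter_upwards [hN] with y hy
    exact apply_flow_eq_of_mfderiv_eq_zero hφ hU hf hker (hmem y hy) hs)
  exact congrArg (fun L : E →L[ℝ] F ↦ L v) (hasMFDerivAt_unique h2 h3)

variable [RiemannianBundle (fun x : M ↦ TangentSpace 𝓘(ℝ, E) x)]

namespace ContactMetricStructure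

variable (S : ContactMetricStructure E M)

theorem inner_horizontal (x : M) (v w : TangentSpace 𝓘(ℝ, E) x) :
    inner ℝ (v - S.η x v • S.ξ x) (w - S.η x w • S.ξ x) = inner ℝ v w - S.η x v * S.η x w := by
  have h : inner ℝ v (S.ξ x) = S.η x v := by rw [real_inner_comm, S.inner_ξ_left]
  rw [inner_sub_left, inner_sub_right, inner_sub_right, inner_smul_left, inner_smul_left,
    inner_smul_right, inner_smul_right, S.inner_ξ_ξ, S.inner_ξ_left, h]
  simp
  ring

theorem inner_ξ_horizontal (x : M) (v : TangentSpace 𝓘(ℝ, E) x) :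
    inner ℝ (S.ξ x) (v - S.η x v • S.ξ x) = (0 : ℝ) := by
  rw [S.inner_ξ_left, map_sub, map_smul, (S.reeb x).1]
  simp

variable [FiniteDimensional ℝ E] [T2Space M] {S} {φ : ℝ → M → M}

/-- Splitting off the `ξ` components gives `g = f^*h + η ⊗ η` on `U`. Both summands are invariant
under the flow for small times, so the metric has zero derivative along it. -/
theorem isIsometricFlow_of_isBundleLike (hφ : IsGlobalFlow S.ξ φ) {q : ℕ}
    (h : IsBundleLike q S.ξ) : IsIsometricFlow (E := E) φ := by
  refine isIsometricFlow_of_hasDerivAt_zero S.smooth_ξ hφ fun x v w ↦ ?_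
  obtain ⟨U, f, k, hU, hx, hf, -, hker, -, -, hk⟩ := h x
  have hξ : ∀ y ∈ U, mfderiv 𝓘(ℝ, E) 𝓘(ℝ, EuclideanSpace ℝ (Fin q)) f y (S.ξ y) = 0 := by
    intro y hy
    have : S.ξ y ∈ (mfderiv 𝓘(ℝ, E) 𝓘(ℝ, EuclideanSpace ℝ (Fin q)) f y).ker := by
      rw [hker y hy]
      exact Submodule.mem_span_singleton_self _
    exact this
  have hinner : ∀ y ∈ U, ∀ v w : TangentSpace 𝓘(ℝ, E) y,
      inner ℝ v w = k (f y) (mfderiv 𝓘(ℝ, E) 𝓘(ℝ, EuclideanSpace ℝ (Fin q)) f y v)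
        (mfderiv 𝓘(ℝ, E) 𝓘(ℝ, EuclideanSpace ℝ (Fin q)) f y w) + S.η y v * S.η y w := by
    intro y hy v w
    have h1 := hk y hy _ _ (S.inner_ξ_horizontal y v) (S.inner_ξ_horizontal y w)
    rw [S.inner_horizontal] at h1
    have h2 : ∀ v : TangentSpace 𝓘(ℝ, E) y,
        mfderiv 𝓘(ℝ, E) 𝓘(ℝ, EuclideanSpace ℝ (Fin q)) f y (v - S.η y v • S.ξ y)
          = mfderiv 𝓘(ℝ, E) 𝓘(ℝ, EuclideanSpace ℝ (Fin q)) f y v := by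
      intro v
      rw [map_sub, map_smul, hξ y hy, smul_zero, sub_zero]
    rw [h2, h2] at h1
    linarith
  refine (hasDerivAt_const 0 (inner ℝ v w : ℝ)).congr_of_eventuallyEq ?_
  filter_upwards [eventually_mfderiv_comp_flow_eq hφ hU hf hξ hx] with s hs
  have h1 := hinner _ hs.1 (mfderiv 𝓘(ℝ, E) 𝓘(ℝ, E) (φ s) x v)
    (mfderiv 𝓘(ℝ, E) 𝓘(ℝ, E) (φ s) x w)
  have h2 := hinner x hx v w
  rw [η_mfderiv_flow hφ, η_mfderiv_flow hφ] at h1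
  refine h1.trans (Eq.trans ?_ h2.symm)
  congr 1
  have h3 : ∀ (a b : EuclideanSpace ℝ (Fin q)) (a' b' : EuclideanSpace ℝ (Fin q))
    (z z' : EuclideanSpace ℝ (Fin q)), a = a' → b = b' → z = z' → k z a b = k z' a' b' := by
    rintro _ _ _ _ _ _ rfl rfl rfl
    rfl
  exact h3 _ _ _ _ _ _ (hs.2.2 v) (hs.2.2 w) hs.2.1

end ContactMetricStructure

end BundleLike

/-! ### Flow boxes over a transverse slice -/

section FlowBox

variable {E : Type*} [NormedAddCommGroup E] [NormedSpace ℝ E]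
  {M : Type*} [TopologicalSpace M] [ChartedSpace E M]
  {Z : Type*} [NormedAddCommGroup Z] [NormedSpace ℝ Z]

/-- The affine slice through `x` in the direction of `ι`, in the preferred chart at `x`. -/
def slicePoint (x : M) (ι : Z →L[ℝ] E) (z : Z) : E := extChartAt 𝓘(ℝ, E) x x + ι z

/-- The flow of a slice. -/
def flowOut (φ : ℝ → M → M) (x : M) (ι : Z →L[ℝ] E) (p : ℝ × Z) : M :=
  φ p.1 ((extChartAt 𝓘(ℝ, E) x).symm (slicePoint x ι p.2))

/-- The differential of `flowOut φ x ι` in the direction of the slice. -/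
def flowOutSliceD (φ : ℝ → M → M) (x : M) (ι : Z →L[ℝ] E) (p : ℝ × Z) :
    Z →L[ℝ] TangentSpace 𝓘(ℝ, E) (flowOut φ x ι p) :=
  (mfderiv 𝓘(ℝ, E) 𝓘(ℝ, E) (φ p.1) ((extChartAt 𝓘(ℝ, E) x).symm (slicePoint x ι p.2))).comp
    ((chartDInv x (slicePoint x ι p.2)).comp ι)

theorem contDiff_slicePoint (x : M) (ι : Z →L[ℝ] E) : ContDiff ℝ ∞ (slicePoint x ι) :=
  contDiff_const.add ι.contDiff

theorem slicePoint_zero (x : M) (ι : Z →L[ℝ] E) :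
    slicePoint x ι 0 = extChartAt 𝓘(ℝ, E) x x := by
  simp [slicePoint]

variable [IsManifold 𝓘(ℝ, E) ∞ M] {ξ : VField E M} {φ : ℝ → M → M}

theorem contMDiffAt_flowOut (hφ : IsGlobalFlow ξ φ) (x : M) (ι : Z →L[ℝ] E) {p : ℝ × Z}
    (hp : slicePoint x ι p.2 ∈ (extChartAt 𝓘(ℝ, E) x).target) :
    ContMDiffAt 𝓘(ℝ, ℝ × Z) 𝓘(ℝ, E) ∞ (flowOut φ x ι) p := by
  have h1 := (contMDiffOn_flow_extChartAt_symm hφ x).contMDiffAt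
    (x := (p.1, slicePoint x ι p.2))
    ((isOpen_univ.prod (isOpen_extChartAt_target x)).mem_nhds ⟨mem_univ _, hp⟩)
  have h2 : ContMDiff 𝓘(ℝ, ℝ × Z) 𝓘(ℝ, ℝ × E) ∞
      (fun p : ℝ × Z ↦ (p.1, slicePoint x ι p.2)) :=
    (contDiff_fst.prodMk ((contDiff_slicePoint x ι).comp contDiff_snd)).contMDiff
  exact h1.comp p h2.contMDiffAt

/-- For a fixed point of the slice the map is an orbit; at a fixed time it is the flow map applied
to the slice. Linearity adds the two directions. -/
theorem mfderiv_flowOut (hφ : IsGlobalFlow ξ φ) (x : M) (ι : Z →L[ℝ] E) {p : ℝ × Z}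
    (hp : slicePoint x ι p.2 ∈ (extChartAt 𝓘(ℝ, E) x).target) (s : ℝ) (b : Z) :
    mfderiv 𝓘(ℝ, ℝ × Z) 𝓘(ℝ, E) (flowOut φ x ι) p (s, b) =
      s • ξ (flowOut φ x ι p) + flowOutSliceD φ x ι p b := by
  have hD := ((contMDiffAt_flowOut hφ x ι hp).mdifferentiableAt (by simp)).hasMFDerivAt
  set D : ℝ × Z →L[ℝ] E := mfderiv 𝓘(ℝ, ℝ × Z) 𝓘(ℝ, E) (flowOut φ x ι) p with hDdef
  have h1 : D (s, 0) = (s • ξ (flowOut φ x ι p) : E) := by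
    have h2 : HasMFDerivAt 𝓘(ℝ, ℝ) 𝓘(ℝ, ℝ × Z) (fun t : ℝ ↦ (t, p.2)) p.1
        (ContinuousLinearMap.inl ℝ ℝ Z) :=
      (hasFDerivAt_prodMk_left p.1 p.2).hasMFDerivAt
    have h3 := HasMFDerivAt.comp p.1 (show HasMFDerivAt 𝓘(ℝ, ℝ × Z) 𝓘(ℝ, E) (flowOut φ x ι)
      ((fun t : ℝ ↦ (t, p.2)) p.1) D from hD) h2
    have h4 := hφ.integralCurve ((extChartAt 𝓘(ℝ, E) x).symm (slicePoint x ι p.2)) p.1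
    exact congrArg (fun L : ℝ →L[ℝ] E ↦ L s) (hasMFDerivAt_unique h3 h4)
  have h1' : D (0, b) = (flowOutSliceD φ x ι p b : E) := by
    have h2 : HasMFDerivAt 𝓘(ℝ, Z) 𝓘(ℝ, ℝ × Z) (fun z : Z ↦ (p.1, z)) p.2
        (ContinuousLinearMap.inr ℝ ℝ Z) :=
      (hasFDerivAt_prodMk_right p.1 p.2).hasMFDerivAt
    have h3 := HasMFDerivAt.comp p.2 (show HasMFDerivAt 𝓘(ℝ, ℝ × Z) 𝓘(ℝ, E) (flowOut φ x ι)
      ((fun z : Z ↦ (p.1, z)) p.2) D from hD) h2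
    have h4 : HasMFDerivAt 𝓘(ℝ, Z) 𝓘(ℝ, E) (slicePoint x ι) p.2 ι :=
      (ι.hasFDerivAt.const_add _).hasMFDerivAt
    have h5 := (hφ.mdifferentiableAt p.1 _).hasMFDerivAt.comp p.2
      ((hasMFDerivAt_extChartAt_symm hp).comp p.2 h4)
    exact congrArg (fun L : Z →L[ℝ] E ↦ L b) (hasMFDerivAt_unique h3 h5)
  have h6 : ((s, b) : ℝ × Z) = (s, 0) + (0, b) := by simp
  exact (congrArg D h6).trans ((map_add D _ _).trans (congrArg₂ (fun a b : E ↦ a + b) h1 h1'))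

/-- A flow box: the flow of a slice transverse to the vector field is a local diffeomorphism. -/
theorem exists_flowBox [CompleteSpace E] [CompleteSpace Z] (hφ : IsGlobalFlow ξ φ) (x : M)
    (ι : Z →L[ℝ] E) (L : (ℝ × Z) ≃L[ℝ] E) (hL : ∀ s z, L (s, z) = s • fieldInChart ξ x (extChartAt 𝓘(ℝ, E) x x) + ι z) :
    ∃ (U : Set M) (W : Set (ℝ × Z)) (P : M → ℝ × Z), IsOpen U ∧ x ∈ U ∧ IsOpen W ∧
      ContMDiffOn 𝓘(ℝ, E) 𝓘(ℝ, ℝ × Z) ∞ P U ∧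
      (∀ p ∈ W, slicePoint x ι p.2 ∈ (extChartAt 𝓘(ℝ, E) x).target ∧
        flowOut φ x ι p ∈ U ∧ P (flowOut φ x ι p) = p) ∧
      ∀ y ∈ U, P y ∈ W ∧ flowOut φ x ι (P y) = y := by
  set κ := extChartAt 𝓘(ℝ, E) x with hκ
  let O : Set (ℝ × Z) := (fun p : ℝ × Z ↦ (p.1, slicePoint x ι p.2)) ⁻¹' flowDomain (E := E) φ x
  have hmap : ContDiff ℝ ∞ (fun p : ℝ × Z ↦ (p.1, slicePoint x ι p.2)) :=
    contDiff_fst.prodMk ((contDiff_slicePoint x ι).comp contDiff_snd)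
  have hO : IsOpen O := (isOpen_flowDomain hφ x).preimage hmap.continuous
  let G : ℝ × Z → E := fun p ↦ flowInChart φ x (p.1, slicePoint x ι p.2)
  have hGdef : ∀ p, G p = κ (flowOut φ x ι p) := fun p ↦ rfl
  have hG : ContDiffOn ℝ ∞ G O := (contDiffOn_flowInChart hφ x).comp hmap.contDiffOn (fun _ h ↦ h)
  have hxt : κ x ∈ κ.target := mem_extChartAt_target x
  have h0 : (0 : ℝ × Z) ∈ O := by
    change ((0 : ℝ), slicePoint x ι 0) ∈ flowDomain φ x
    rw [slicePoint_zero]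
    exact zero_mem_flowDomain hφ hxt
  have hd := ((hG.contDiffAt (hO.mem_nhds h0)).differentiableAt (by simp)).hasFDerivAt
  -- At the origin the time direction gives `ξ`, and the slice direction gives `ι` because the flow
  -- at time `0` is the identity. Transversality is the invertibility of `L`.
  have hGd : HasFDerivAt G (L : (ℝ × Z) →L[ℝ] E) 0 := by
    refine hd.congr_fderiv (ContinuousLinearMap.ext fun p ↦ ?_)
    obtain ⟨s, z⟩ := p
    set D := fderiv ℝ G 0
    have h1 : D (1, 0) = fieldInChart ξ x (κ x) := by
      have h2 := HasFDerivAt.comp (f := fun t : ℝ ↦ (t, (0 : Z))) (0 : ℝ) hd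
        (hasFDerivAt_prodMk_left (𝕜 := ℝ) (0 : ℝ) (0 : Z))
      have h3 : HasDerivAt (fun t ↦ flowInChart φ x (t, slicePoint x ι 0)) _ 0 :=
        hasDerivAt_flowInChart hφ h0
      have h4 := h2.hasDerivAt.unique h3
      rwa [slicePoint_zero, flowInChart_zero hφ hxt] at h4
    have h1' : D (0, z) = ι z := by
      have h2 := HasFDerivAt.comp (f := fun z : Z ↦ ((0 : ℝ), z)) (0 : Z) hd
        (hasFDerivAt_prodMk_right (𝕜 := ℝ) (0 : ℝ) (0 : Z))
      have h3 : HasFDerivAt (slicePoint x ι) ι 0 := ι.hasFDerivAt.const_add _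
      have h4 : HasFDerivAt (G ∘ fun z : Z ↦ ((0 : ℝ), z)) ι 0 := by
        refine h3.congr_of_eventuallyEq ?_
        have : slicePoint x ι ⁻¹' κ.target ∈ nhds 0 :=
          (contDiff_slicePoint x ι).continuous.continuousAt.preimage_mem_nhds (by
            rw [slicePoint_zero]
            exact (isOpen_extChartAt_target x).mem_nhds hxt)
        filter_upwards [this] with z hz
        exact flowInChart_zero hφ hz
      exact congrArg (fun L : Z →L[ℝ] E ↦ L z) (h2.unique h4)
    have h6 : ((s, z) : ℝ × Z) = s • ((1 : ℝ), (0 : Z)) + (0, z) := by simp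
    change D (s, z) = L (s, z)
    rw [hL, h6, map_add, map_smul, h1, h1']
  obtain ⟨e, he0, heO, heG, hesymm⟩ := exists_openPartialHomeomorph_contDiffOn hO hG h0 hGd
  have hsrc : ∀ p ∈ e.source, slicePoint x ι p.2 ∈ κ.target ∧ flowOut φ x ι p ∈ κ.source :=
    fun p hp ↦ heO hp
  have hU : IsOpen (κ.source ∩ κ ⁻¹' e.target) :=
    (continuousOn_extChartAt x).isOpen_inter_preimage (isOpen_extChartAt_source x) e.open_target
  refine ⟨κ.source ∩ κ ⁻¹' e.target, e.source, e.symm ∘ κ, hU, ?_, e.open_source, ?_, ?_, ?_⟩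
  · refine ⟨mem_extChartAt_source x, ?_⟩
    have h1 := e.map_source he0
    rw [heG] at h1
    have h2 : G 0 = κ x := by
      change flowInChart φ x (0, slicePoint x ι 0) = κ x
      rw [slicePoint_zero, flowInChart_zero hφ hxt]
    rwa [h2] at h1
  · refine hesymm.contMDiffOn.comp
      ((contMDiffOn_extChartAt (I := 𝓘(ℝ, E)) (n := ∞) (x := x)).mono ?_) (fun y hy ↦ hy.2)
    intro y hy
    have := hy.1
    rwa [hκ, extChartAt_source] at this
  · intro p hp
    have h1 := hsrc p hp
    have h2 : κ (flowOut φ x ι p) = e p := (heG p).symm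
    refine ⟨h1.1, ⟨h1.2, ?_⟩, ?_⟩
    · rw [mem_preimage, h2]
      exact e.map_source hp
    · simp only [Function.comp]
      rw [h2, e.left_inv hp]
  · intro y hy
    have h1 : e.symm (κ y) ∈ e.source := e.map_target hy.2
    refine ⟨h1, ?_⟩
    have h2 : κ (flowOut φ x ι (e.symm (κ y))) = κ y := by
      rw [← hGdef, ← heG, e.right_inv hy.2]
    exact κ.injOn (hsrc _ h1).2 hy.1 h2

/-- Differentiating the two identities between the flow box and its inverse splits each tangent
vector uniquely into a multiple of `ξ` and a transported slice vector; `Q` reads off the two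
components. -/
theorem exists_hasMFDerivAt_flowBox_inverse (hφ : IsGlobalFlow ξ φ) (x : M) (ι : Z →L[ℝ] E)
    {U : Set M} {W : Set (ℝ × Z)} {P : M → ℝ × Z} (hU : IsOpen U) (hW : IsOpen W)
    (hP : ContMDiffOn 𝓘(ℝ, E) 𝓘(ℝ, ℝ × Z) ∞ P U)
    (hWU : ∀ p ∈ W, slicePoint x ι p.2 ∈ (extChartAt 𝓘(ℝ, E) x).target ∧
      flowOut φ x ι p ∈ U ∧ P (flowOut φ x ι p) = p)
    (hUW : ∀ y ∈ U, flowOut φ x ι (P y) = y) {p : ℝ × Z} (hp : p ∈ W) :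
    ∃ Q : TangentSpace 𝓘(ℝ, E) (flowOut φ x ι p) →L[ℝ] ℝ × Z,
      HasMFDerivAt 𝓘(ℝ, E) 𝓘(ℝ, ℝ × Z) P (flowOut φ x ι p) Q ∧
      (∀ v, v = (Q v).1 • ξ (flowOut φ x ι p) + flowOutSliceD φ x ι p (Q v).2) ∧
      ∀ s b, Q (s • ξ (flowOut φ x ι p) + flowOutSliceD φ x ι p b) = (s, b) := by
  obtain ⟨hpt, hpU, hPp⟩ := hWU p hp
  have hH := ((contMDiffAt_flowOut hφ x ι hpt).mdifferentiableAt (by simp)).hasMFDerivAt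
  have hQ := ((hP.contMDiffAt (hU.mem_nhds hpU)).mdifferentiableAt (by simp)).hasMFDerivAt
  have hD := mfderiv_flowOut hφ x ι hpt
  have hH' : ∀ (D : ℝ × Z →L[ℝ] E), HasMFDerivAt 𝓘(ℝ, ℝ × Z) 𝓘(ℝ, E) (flowOut φ x ι) p D →
      ∀ r, r = p → HasMFDerivAt 𝓘(ℝ, ℝ × Z) 𝓘(ℝ, E) (flowOut φ x ι) r D := by
    rintro D h _ rfl
    exact h
  refine ⟨_, hQ, fun v ↦ ?_, fun s b ↦ ?_⟩
  · have h1 := (hH' _ hH _ hPp).comp (flowOut φ x ι p) hQ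
    have h2 := (hasMFDerivAt_id (I := 𝓘(ℝ, E)) (flowOut φ x ι p)).congr_of_eventuallyEq
      (f₁ := flowOut φ x ι ∘ P) (by
        filter_upwards [hU.mem_nhds hpU] with y hy
        exact hUW y hy)
    have h3 := congrArg (fun L : E →L[ℝ] E ↦ L v) (hasMFDerivAt_unique h2 h1)
    exact h3.trans (hD _ _)
  · have h1 := hQ.comp p hH
    have h2 := (hasMFDerivAt_id (I := 𝓘(ℝ, ℝ × Z)) p).congr_of_eventuallyEq
      (f₁ := P ∘ flowOut φ x ι) (by
        filter_upwards [hW.mem_nhds hp] with r hr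
        exact (hWU r hr).2.2)
    have h3 := congrArg (fun L : ℝ × Z →L[ℝ] ℝ × Z ↦ L (s, b)) (hasMFDerivAt_unique h1 h2)
    exact (congrArg (mfderiv 𝓘(ℝ, E) 𝓘(ℝ, ℝ × Z) P (flowOut φ x ι p)) (hD s b).symm).trans h3

end FlowBox

/-! ### The transverse bilinear form on a slice -/

section SliceMetric

variable {E : Type*} [NormedAddCommGroup E] [NormedSpace ℝ E]
  {M : Type*} [TopologicalSpace M] [ChartedSpace E M]
  {Z : Type*} [NormedAddCommGroup Z] [NormedSpace ℝ Z]

/-- The bilinear form `g - η ⊗ η` on a slice. -/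
def sliceMetric (g : ∀ x : M, TangentSpace 𝓘(ℝ, E) x →L[ℝ] TangentSpace 𝓘(ℝ, E) x →L[ℝ] ℝ)
    (η : OneForm E M) (x : M) (ι : Z →L[ℝ] E) (z : Z) : Z →L[ℝ] Z →L[ℝ] ℝ :=
  (ContinuousLinearMap.precomp ℝ ι).comp ((tensorInChart g x (slicePoint x ι z)).comp ι)
    - ((formInChart η x (slicePoint x ι z)).comp ι).smulRight
      ((formInChart η x (slicePoint x ι z)).comp ι)

variable [IsManifold 𝓘(ℝ, E) ∞ M]

theorem contDiffOn_sliceMetric [FiniteDimensional ℝ E] [FiniteDimensional ℝ Z]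
    {g : ∀ x : M, TangentSpace 𝓘(ℝ, E) x →L[ℝ] TangentSpace 𝓘(ℝ, E) x →L[ℝ] ℝ}
    (hg : ContMDiff 𝓘(ℝ, E) (𝓘(ℝ, E).prod 𝓘(ℝ, E →L[ℝ] E →L[ℝ] ℝ)) ∞
      (fun b ↦ TotalSpace.mk' (E →L[ℝ] E →L[ℝ] ℝ)
        (E := fun b : M ↦ TangentSpace 𝓘(ℝ, E) b →L[ℝ] TangentSpace 𝓘(ℝ, E) b →L[ℝ] ℝ) b (g b)))
    {η : OneForm E M} (hη : SmoothOneForm η) (x : M) (ι : Z →L[ℝ] E) {s : Set Z}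
    (hs : ∀ z ∈ s, slicePoint x ι z ∈ (extChartAt 𝓘(ℝ, E) x).target) :
    ContDiffOn ℝ ∞ (sliceMetric g η x ι) s := by
  have hσ : ContDiffOn ℝ ∞ (slicePoint x ι) s := (contDiff_slicePoint x ι).contDiffOn
  have hA : ∀ a : Z, ContDiffOn ℝ ∞ (fun z ↦ formInChart η x (slicePoint x ι z) (ι a)) s :=
    fun a ↦ ((contDiffOn_formInChart hη x).comp hσ hs).clm_apply contDiffOn_const
  have hB : ∀ a b : Z, ContDiffOn ℝ ∞
      (fun z ↦ tensorInChart g x (slicePoint x ι z) (ι a) (ι b)) s := fun a b ↦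
    (contDiffOn_clm_apply.1 (contDiffOn_clm_apply.1 (contDiffOn_tensorInChart hg x) (ι a))
      (ι b)).comp hσ hs
  rw [contDiffOn_clm_apply]
  intro a
  rw [contDiffOn_clm_apply]
  intro b
  exact (hB a b).sub ((hA a).mul (hA b))

end SliceMetric

/-! ### From isometric flows to bundle-like metrics -/

section TransverseMetric

variable {E : Type*} [NormedAddCommGroup E] [NormedSpace ℝ E] [FiniteDimensional ℝ E]
  {M : Type*} [TopologicalSpace M] [ChartedSpace E M] [IsManifold 𝓘(ℝ, E) ∞ M]

/-- A hyperplane, parametrized by a Euclidean space, complementary to a line. -/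
theorem exists_slice_directions {q : ℕ} (hq : Module.finrank ℝ E = q + 1) (ℓ : E →L[ℝ] ℝ) {a : E}
    (ha : ℓ a = 1) : ∃ (ι : EuclideanSpace ℝ (Fin q) →L[ℝ] E)
      (L : (ℝ × EuclideanSpace ℝ (Fin q)) ≃L[ℝ] E), ∀ s z, L (s, z) = s • a + ι z := by
  have hsurj : Function.Surjective (ℓ : E →ₗ[ℝ] ℝ) := fun c ↦ ⟨c • a, by simp [ha]⟩
  have h1 := LinearMap.finrank_range_add_finrank_ker (ℓ : E →ₗ[ℝ] ℝ)
  rw [LinearMap.range_eq_top.2 hsurj, finrank_top, Module.finrank_self, hq] at h1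
  have h2 : Module.finrank ℝ (EuclideanSpace ℝ (Fin q))
      = Module.finrank ℝ (LinearMap.ker (ℓ : E →ₗ[ℝ] ℝ)) := by
    rw [finrank_euclideanSpace_fin]
    omega
  let e := LinearEquiv.ofFinrankEq _ _ h2
  let ι : EuclideanSpace ℝ (Fin q) →L[ℝ] E :=
    LinearMap.toContinuousLinearMap ((LinearMap.ker (ℓ : E →ₗ[ℝ] ℝ)).subtype ∘ₗ e.toLinearMap)
  have hι : ∀ z, ℓ (ι z) = 0 := fun z ↦ (e z).2
  have hιinj : ∀ z, ι z = 0 → z = 0 := fun z hz ↦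
    (LinearEquiv.map_eq_zero_iff e).1 (Subtype.ext hz)
  let L₀ : (ℝ × EuclideanSpace ℝ (Fin q)) →ₗ[ℝ] E :=
    ((LinearMap.toSpanSingleton ℝ E a).coprod ι.toLinearMap)
  have hL₀ : ∀ s z, L₀ (s, z) = s • a + ι z := fun s z ↦ rfl
  have hinj : Function.Injective L₀ := by
    rw [← LinearMap.ker_eq_bot, LinearMap.ker_eq_bot']
    rintro ⟨s, z⟩ h
    rw [hL₀] at h
    have hs := congrArg ℓ h
    rw [map_add, map_smul, ha, hι, map_zero, add_zero, smul_eq_mul, mul_one] at hs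
    subst hs
    rw [zero_smul, zero_add] at h
    rw [hιinj z h]
    rfl
  have hdim : Module.finrank ℝ (ℝ × EuclideanSpace ℝ (Fin q)) = Module.finrank ℝ E := by
    rw [Module.finrank_prod, finrank_euclideanSpace_fin, Module.finrank_self, hq, add_comm]
  refine ⟨ι, (LinearEquiv.ofInjectiveOfFinrankEq L₀ hinj hdim).toContinuousLinearEquiv, ?_⟩
  intro s z
  exact hL₀ s z

variable [T2Space M] [RiemannianBundle (fun x : M ↦ TangentSpace 𝓘(ℝ, E) x)]
  [IsContMDiffRiemannianBundle 𝓘(ℝ, E) ∞ E (fun x : M ↦ TangentSpace 𝓘(ℝ, E) x)]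

namespace ContactMetricStructure

variable {S : ContactMetricStructure E M} {φ : ℝ → M → M}

/-- If the Reeb flow is isometric, then the metric is bundle-like. -/
theorem isBundleLike_of_isIsometricFlow {q : ℕ} (hq : Module.finrank ℝ E = q + 1)
    (hφ : IsGlobalFlow S.ξ φ) (hiso : IsIsometricFlow (E := E) φ) : IsBundleLike q S.ξ := by
  intro x
  obtain ⟨g, hg, hinner⟩ := IsContMDiffRiemannianBundle.exists_contMDiff (IB := 𝓘(ℝ, E)) (n := ∞)
    (F := E) (E := fun x : M ↦ TangentSpace 𝓘(ℝ, E) x)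
  obtain ⟨ι, L, hL⟩ := exists_slice_directions hq (S.η x)
    (a := fieldInChart S.ξ x (extChartAt 𝓘(ℝ, E) x x))
    ((congrArg (S.η x) (fieldInChart_self S.ξ x)).trans (S.reeb x).1)
  obtain ⟨U, W, P, hU, hxU, hW, hP, hWU, hUW⟩ := exists_flowBox hφ x ι L hL
  let H := flowOut φ x ι
  -- Forgetting the time coordinate of the flow box is the projection onto the local leaf space.
  let f : M → EuclideanSpace ℝ (Fin q) := fun y ↦ (P y).2
  have hf : ContMDiffOn 𝓘(ℝ, E) 𝓘(ℝ, EuclideanSpace ℝ (Fin q)) ∞ f U :=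
    contDiff_snd.contMDiff.comp_contMDiffOn hP
  let K : ∀ (p : ℝ × EuclideanSpace ℝ (Fin q)) (b : EuclideanSpace ℝ (Fin q)),
      TangentSpace 𝓘(ℝ, E) ((extChartAt 𝓘(ℝ, E) x).symm (slicePoint x ι p.2)) :=
    fun p b ↦ chartDInv x (slicePoint x ι p.2) (ι b)
  have hK : ∀ p b, flowOutSliceD φ x ι p b = mfderiv 𝓘(ℝ, E) 𝓘(ℝ, E) (φ p.1) _ (K p b) :=
    fun p b ↦ rfl
  have hmetric : ∀ p a b, sliceMetric g S.η x ι p.2 a b = inner ℝ (K p a) (K p b)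
      - S.η _ (K p a) * S.η _ (K p b) := fun p a b ↦
    congrArg (· - S.η _ (K p a) * S.η _ (K p b)) (hinner _ (K p a) (K p b)).symm
  have hdiff : ∀ p ∈ W, ∃ Q : TangentSpace 𝓘(ℝ, E) (H p) →L[ℝ] ℝ × EuclideanSpace ℝ (Fin q),
      (∀ v, mfderiv 𝓘(ℝ, E) 𝓘(ℝ, EuclideanSpace ℝ (Fin q)) f (H p) v = (Q v).2) ∧
      (∀ v, v = (Q v).1 • S.ξ (H p) + flowOutSliceD φ x ι p (Q v).2) ∧
      ∀ s b, Q (s • S.ξ (H p) + flowOutSliceD φ x ι p b) = (s, b) := by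
    intro p hp
    obtain ⟨Q, hQP, hQ⟩ := exists_hasMFDerivAt_flowBox_inverse hφ x ι hU hW hP hWU
      (fun y hy ↦ (hUW y hy).2) hp
    refine ⟨Q, fun v ↦ ?_, hQ⟩
    have h1 : HasMFDerivAt 𝓘(ℝ, ℝ × EuclideanSpace ℝ (Fin q)) 𝓘(ℝ, EuclideanSpace ℝ (Fin q))
        Prod.snd (P (H p)) (ContinuousLinearMap.snd ℝ ℝ (EuclideanSpace ℝ (Fin q))) :=
      hasFDerivAt_snd.hasMFDerivAt
    exact congrArg (fun L : E →L[ℝ] EuclideanSpace ℝ (Fin q) ↦ L v) (h1.comp (H p) hQP).mfderiv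
  have hξH : ∀ p, mfderiv 𝓘(ℝ, E) 𝓘(ℝ, E) (φ p.1) _ (S.ξ _) = S.ξ (H p) := fun p ↦
    mfderiv_flow_apply_self S.smooth_ξ hφ p.1 ((extChartAt 𝓘(ℝ, E) x).symm (slicePoint x ι p.2))
  refine ⟨U, f, sliceMetric g S.η x ι, hU, hxU, hf, ?_, ?_, ?_, ?_, ?_⟩
  · intro y hy b
    obtain ⟨p, hp, rfl⟩ : ∃ p ∈ W, H p = y := ⟨P y, hUW y hy⟩
    obtain ⟨Q, hQf, -, hQ⟩ := hdiff p hp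
    refine ⟨(0 : ℝ) • S.ξ (H p) + flowOutSliceD φ x ι p b, ?_⟩
    exact (hQf _).trans (congrArg Prod.snd (hQ 0 b))
  · intro y hy
    obtain ⟨p, hp, rfl⟩ : ∃ p ∈ W, H p = y := ⟨P y, hUW y hy⟩
    obtain ⟨Q, hQf, hQv, hQ⟩ := hdiff p hp
    refine le_antisymm (fun v hv ↦ ?_) ?_
    · have h1 : (Q v).2 = 0 := (hQf v).symm.trans hv
      rw [Submodule.mem_span_singleton]
      refine ⟨(Q v).1, ?_⟩
      have h2 := hQv v
      rw [h1, map_zero, add_zero] at h2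
      exact h2.symm
    · rw [Submodule.span_singleton_le_iff_mem]
      have h1 := hQ 1 0
      rw [map_zero, add_zero, one_smul] at h1
      exact (hQf _).trans (congrArg Prod.snd h1)
  · refine contDiffOn_sliceMetric hg S.smooth_η x ι ?_
    rintro _ ⟨y, hy, rfl⟩
    exact (hWU _ (hUW y hy).1).1
  · rintro _ ⟨y, hy, rfl⟩
    obtain ⟨p, hp, rfl⟩ : ∃ p ∈ W, H p = y := ⟨P y, hUW y hy⟩
    have hfp : f (H p) = p.2 := congrArg Prod.snd (hWU p hp).2.2
    rw [hfp]
    refine ⟨fun a b ↦ ?_, fun a ha ↦ ?_⟩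
    · rw [hmetric, hmetric, real_inner_comm, mul_comm]
    · obtain ⟨Q, -, -, hQ⟩ := hdiff p hp
      rw [hmetric, ← S.inner_horizontal]
      refine lt_of_le_of_ne real_inner_self_nonneg fun h0 ↦ ha ?_
      -- A slice vector of length zero for the form would be a multiple of `ξ`. Transported by the
      -- flow it would have coordinates both `(0, a)` and `(c, 0)` in the flow box, so `a = 0`.
      have h1 := sub_eq_zero.1 (inner_self_eq_zero.1 h0.symm)
      have h2 := congrArg (mfderiv 𝓘(ℝ, E) 𝓘(ℝ, E) (φ p.1) _) h1
      rw [map_smul, hξH, ← hK] at h2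
      have h3 := hQ 0 a
      have h4 := hQ (S.η _ (K p a)) 0
      rw [map_zero, add_zero] at h4
      rw [zero_smul, zero_add] at h3
      exact congrArg Prod.snd (h3.symm.trans ((congrArg Q h2).trans h4))
  · intro y hy v w hv hw
    obtain ⟨p, hp, rfl⟩ : ∃ p ∈ W, H p = y := ⟨P y, hUW y hy⟩
    have hfp : f (H p) = p.2 := congrArg Prod.snd (hWU p hp).2.2
    obtain ⟨Q, hQf, hQv, -⟩ := hdiff p hp
    -- A vector orthogonal to `ξ` is the transport of the horizontal part of the slice vector with
    -- the same leaf coordinate. The isometry then moves its inner products back to the slice, where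
    -- they are given by `sliceMetric`.
    have hlift : ∀ v : TangentSpace 𝓘(ℝ, E) (H p), inner ℝ (S.ξ (H p)) v = (0 : ℝ) →
        v = mfderiv 𝓘(ℝ, E) 𝓘(ℝ, E) (φ p.1) _
          (K p (Q v).2 - S.η _ (K p (Q v).2) • S.ξ _) := by
      intro v hv
      have h1 : S.η (H p) v = 0 := by rw [← S.inner_ξ_left, hv]
      have h2 := congrArg (S.η (H p)) (hQv v)
      have h3 : S.η (H p) (flowOutSliceD φ x ι p (Q v).2) = S.η _ (K p (Q v).2) :=
        η_mfderiv_flow hφ p.1 _ _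
      rw [h1, map_add, map_smul, (S.reeb _).1, h3, smul_eq_mul, mul_one] at h2
      have h4 := hQv v
      rw [map_sub, map_smul, hξH, ← hK]
      rw [eq_neg_of_add_eq_zero_left h2.symm] at h4
      rw [neg_smul, neg_add_eq_sub] at h4
      exact h4
    have h1 := hiso p.1 _ (K p (Q v).2 - S.η _ (K p (Q v).2) • S.ξ _)
      (K p (Q w).2 - S.η _ (K p (Q w).2) • S.ξ _)
    rw [S.inner_horizontal, ← hmetric] at h1
    have h2 := congrArg₂ (fun a b : TangentSpace 𝓘(ℝ, E) (H p) ↦ (inner ℝ a b : ℝ))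
      (hlift v hv) (hlift w hw)
    refine h2.trans (h1.trans ?_)
    rw [hQf, hQf, hfp]

end ContactMetricStructure

end TransverseMetric

end ContactGeometry

end

theorem proposition2p5 (n : ℕ)
    {M : Type*} [EMetricSpace M] [ChartedSpace (EuclideanSpace ℝ (Fin (2 * n + 1))) M]
    [IsManifold 𝓘(ℝ, EuclideanSpace ℝ (Fin (2 * n + 1))) ∞ M]
    [RiemannianBundle (fun x : M ↦ TangentSpace 𝓘(ℝ, EuclideanSpace ℝ (Fin (2 * n + 1))) x)]
    [IsContMDiffRiemannianBundle 𝓘(ℝ, EuclideanSpace ℝ (Fin (2 * n + 1))) ∞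
      (EuclideanSpace ℝ (Fin (2 * n + 1)))
      (fun x : M ↦ TangentSpace 𝓘(ℝ, EuclideanSpace ℝ (Fin (2 * n + 1))) x)]
    [IsRiemannianManifold 𝓘(ℝ, EuclideanSpace ℝ (Fin (2 * n + 1))) M]
    [CompleteSpace M]
    (S : ContactGeometry.ContactMetricStructure (EuclideanSpace ℝ (Fin (2 * n + 1))) M) :
    -- completeness: the Reeb flow is defined for all times
    (∃! φ : ℝ → M → M, ContactGeometry.IsGlobalFlow S.ξ φ) ∧
    ∀ φ : ℝ → M → M, ContactGeometry.IsGlobalFlow S.ξ φ →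
      List.TFAE [
        ContactGeometry.IsBundleLike (2 * n) S.ξ,
        ContactGeometry.IsIsometricFlow (E := EuclideanSpace ℝ (Fin (2 * n + 1))) φ,
        ContactGeometry.PreservesHorizontalEnd φ S.η S.J,
        ContactGeometry.PreservesEnd φ S.Φ,
        S.IsKContact] := by
  refine ⟨ContactGeometry.existsUnique_isGlobalFlow S.smooth_ξ S.inner_ξ_ξ, fun φ hφ ↦ ?_⟩
  tfae_have 1 → 2 := ContactGeometry.ContactMetricStructure.isIsometricFlow_of_isBundleLike hφ
  tfae_have 2 → 1 := ContactGeometry.ContactMetricStructure.isBundleLike_of_isIsometricFlow (by simp) hφ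
  tfae_have 2 → 4 := ContactGeometry.ContactMetricStructure.preservesEnd_of_isIsometricFlow hφ
  tfae_have 4 → 2 := ContactGeometry.ContactMetricStructure.isIsometricFlow_of_preservesEnd hφ
  tfae_have 4 → 3 := ContactGeometry.ContactMetricStructure.preservesHorizontalEnd_of_preservesEnd hφ
  tfae_have 3 → 4 := ContactGeometry.ContactMetricStructure.preservesEnd_of_preservesHorizontalEnd hφ
  tfae_have 5 ↔ 2 := ContactGeometry.isKilling_iff_isIsometricFlow S.smooth_ξ hφ
  tfae_finish
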